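/- **Setting.** Let $T\ge 0$, $d\ge 1$, $m\ge 0$ be integers, let $(\Omega,\mathcal F,P)$ be a probability space with a filtration $(\mathcal F_t)_{t=0}^T$ such that $\mathcal F_0$ contains all $P$-null sets, and let $(S_t)_{t=0}^T$ be adapted with values a.s. in $\mathbb R^m_+$. For $z=(z^1,\dots,z^d)\in\mathbb R^d$ write $z^{(2)}=(z^2,\dots,z^d)$, and let $e_1=(1,0,\dots,0)$. For each $t\le T$ let $\mathrm C_t:\mathbb R^m\times\mathbb R^d\to\mathbb R$ be a (deterministic) Borel function that is lower semicontinuous in $(s,z)$ (hence a normal integrand) and satisfies, for all $s\in\mathbb R^m_+$, $z\in\mathbb R^d$, $a\in\mathbb R$: $\mathrm C_t(s,0)=0$; $\mathrm C_t(s,z+ae_1)=\mathrm C_t(s,z)+a$; $|\mathrm C_t(s,z)|\le h_t(s,z)$ for some continuous function $h_t$; and $\mathrm C_T(s,x)\le \mathrm C_T(s,y)$ whenever $y-x\in\mathbb R^d_+$. Assume that there is an increasing bijection $\delta$ of $[0,\infty]$ such that $\mathrm C_t(s,\lambda z)\ge\delta(\lambda)\,\mathrm C_t(s,z)$ for all $t\le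 T$, $\lambda\ge1$, $s\in\mathbb R^m_+$, $z\in\mathbb R^d$, and that each $\mathrm C_t$, $t\le T$, is either sub-additive or super-additive in $z$ (for all $s\in\mathbb R^m_+$). The solvency sets are $\mathbf G_t=\{z:\ -\mathrm C_t(S_t,-z)\ge 0\}$. For a payoff $\xi\in L^0(\mathbb R^d,\mathcal F_T)$, $t\le T$ and $V_{t-1}\in L^0(\mathbb R^d,\mathcal F_t)$ let $$\gamma_t^{\xi}(V_{t-1})=\operatorname*{ess\,inf}_{\mathcal F_t}\ \operatorname*{ess\,sup}_{\mathcal F_t}\Big(\xi^1+\sum_{u=t}^T\mathrm C_u\big(S_u,(0,V_u^{(2)}-V_{u-1}^{(2)})\big)\Big),$$ where the essential infimum is over all $V_u\in L^0(\mathbb R^d,\mathcal F_u)$, $t\le u\le T-1$, with $V_T=\xi$. Essential suprema and infima are conditional: the smallest (largest) $\mathcal F_t$-measurable $[-\infty,\infty]$-valued random variable dominating (dominated by) the family a.s. For $t<T$ and $Z\in L^0(\mathbb R^d,\mathcal F_t)$ put $D_t^0(S_t,0,Z)=\mathrm C_t(S_t,(0,Z^{(2)}))+\operatorname{ess\,sup}_{\mathcal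 F_t}\gamma_{t+1}^0(Z)$, where the superscript $0$ refers to the payoff $\xi=0$. Condition SAIP says: $\gamma_t^0(0)=0$ a.s. for every $t\le T$, and for every $t<T$ and $Z\in L^0(\mathbb R^d,\mathcal F_t)$ one has $D_t^0(S_t,0,Z)=0$ a.s. if and only if $Z^{(2)}=0$ a.s. An $\mathcal F_t$-normal integrand is a function $f:\Omega\times\mathbb R^k\to\mathbb R$ that is $\mathcal F_t\otimes\mathcal B(\mathbb R^k)$-measurable and lower semicontinuous in its second variable. The conditional support $\mathrm{supp}_{\mathcal F_t}S_{t+1}$ is the smallest $\mathcal F_t$-measurable random closed set that contains $S_{t+1}$ a.s. **Theorem.** Let $\xi=g(S_T)$ with $g:\mathbb R^m\to\mathbb R^d_+$ continuous, and suppose that $\xi$ is hedgeable: there is an adapted process $(V_u)_{u=0}^T$ with $V_u-V_{u-1}\in-\mathbf G_u$ a.s. for $1\le u\le T$ and $V_T=\xi$ a.s. Suppose that for each $t<T$ one has $\mathrm{supp}_{\mathcal F_t}S_{t+1}=\phi_t(S_t)$ a.s., where $\phi_t:\mathbb R^m\rightrightarrows\mathbb R^m$ is lower hemicontinuous with compact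 values and $\phi_t(S_t)\subseteq\bar B(0,R_t(S_t))$ a.s. for a continuous function $R_t$ on $\mathbb R^m$. Suppose that SAIP holds. Then there are functions $\tilde\gamma_t^\xi:\mathbb R^m\times\mathbb R^d\to\mathbb R$, $0\le t\le T$, each of which is an $\mathcal F_t$-normal integrand (not depending on $\omega$), such that: 1. for all $t\le T$ and $V_{t-1}\in L^0(\mathbb R^d,\mathcal F_t)$ (in particular for $V_{t-1}\in L^0(\mathbb R^d,\mathcal F_{t-1})$), $\gamma_t^\xi(V_{t-1})=\tilde\gamma_t^\xi(S_t,V_{t-1})$ a.s.; 2. for all $t<T$ and such $V_{t-1}$, a.s. $$\tilde\gamma_t^\xi(S_t,V_{t-1})=\inf_{y\in\mathbb R^d}\Big(\mathrm C_t\big(S_t,(0,y^{(2)}-V_{t-1}^{(2)})\big)+\sup_{s\in\phi_t(S_t)}\tilde\gamma_{t+1}^\xi(s,y)\Big),$$ and there is $Y\in L^0(\mathbb R^d,\mathcal F_t)$ such that a.s. this infimum is attained at $y=Y$; 3. for all $t\le T$ and such $V_{t-1}$, the infimum hedging cost is reached: there are $V_u\in L^0(\mathbb R^d,\mathcal F_u)$,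 $t\le u\le T-1$, with $V_T=\xi$, such that $\gamma_t^\xi(V_{t-1})=\operatorname{ess\,sup}_{\mathcal F_t}\big(\xi^1+\sum_{u=t}^T\mathrm C_u(S_u,(0,V_u^{(2)}-V_{u-1}^{(2)}))\big)$ a.s. -/

import Mathlib

open MeasureTheory Filter Topology
open scoped ENNReal

noncomputable section

/-! ### Conditional essential suprema and infima -/

/-- `Z` is the conditional essential supremum of the family `𝒳` given the σ-algebra `m`: the
smallest `m`-measurable `[-∞, ∞]`-valued random variable dominating every member of `𝒳` a.s. -/
def IsCondEssSup {Ω : Type*} (m : MeasurableSpace Ω) {_mΩ : MeasurableSpace Ω} (P : Measure Ω)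
    (𝒳 : Set (Ω → EReal)) (Z : Ω → EReal) : Prop :=
  Measurable[m] Z ∧ (∀ X ∈ 𝒳, X ≤ᵐ[P] Z) ∧
    ∀ Z' : Ω → EReal, Measurable[m] Z' → (∀ X ∈ 𝒳, X ≤ᵐ[P] Z') → Z ≤ᵐ[P] Z'

/-- `Z` is the conditional essential infimum of the family `𝒳` given the σ-algebra `m`: the
largest `m`-measurable `[-∞, ∞]`-valued random variable dominated by every member of `𝒳` a.s. -/
def IsCondEssInf {Ω : Type*} (m : MeasurableSpace Ω) {_mΩ : MeasurableSpace Ω} (P : Measure Ω)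
    (𝒳 : Set (Ω → EReal)) (Z : Ω → EReal) : Prop :=
  Measurable[m] Z ∧ (∀ X ∈ 𝒳, Z ≤ᵐ[P] X) ∧
    ∀ Z' : Ω → EReal, Measurable[m] Z' → (∀ X ∈ 𝒳, Z' ≤ᵐ[P] X) → Z' ≤ᵐ[P] Z

/-- Conditional essential suprema exist, for every family and every sub-σ-algebra. -/
theorem exists_isCondEssSup {Ω : Type*} {m mΩ : MeasurableSpace Ω}
    (hm : m ≤ mΩ) (P : Measure Ω) [IsFiniteMeasure P] (𝒳 : Set (Ω → EReal)) :
    ∃ Z : Ω → EReal, IsCondEssSup m P 𝒳 Z := by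
  let f : EReal → ℝ≥0∞ :=
    fun x => ENNReal.ofReal (ENNReal.orderIsoUnitIntervalBirational (EReal.exp x) : ℝ)
  have hf : StrictMono f := by
    intro a b hab
    have h1 : ENNReal.orderIsoUnitIntervalBirational (EReal.exp a)
        < ENNReal.orderIsoUnitIntervalBirational (EReal.exp b) :=
      ENNReal.orderIsoUnitIntervalBirational.strictMono (EReal.exp_strictMono hab)
    exact (ENNReal.ofReal_lt_ofReal_iff_of_nonneg
      (ENNReal.orderIsoUnitIntervalBirational (EReal.exp a)).2.1).2 h1
  have hf1 : ∀ x, f x ≤ 1 := fun x => by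
    simpa [f] using (ENNReal.orderIsoUnitIntervalBirational (EReal.exp x)).2.2
  have hfm : Measurable f := hf.monotone.measurable
  let U : Set (Ω → EReal) := {u | Measurable[m] u ∧ ∀ X ∈ 𝒳, X ≤ᵐ[P] u}
  have hU : U.Nonempty := ⟨fun _ => ⊤, measurable_const, fun X _ => Eventually.of_forall
    fun _ => le_top⟩
  obtain ⟨a, -, ha, haU⟩ := exists_seq_tendsto_sInf
    (hU.image fun u => ∫⁻ ω, f (u ω) ∂P) (OrderBot.bddBelow _)
  choose u huU hua using haU
  let v : Ω → EReal := fun ω => ⨅ n, u n ω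
  have hvm : Measurable[m] v := Measurable.iInf fun n => (huU n).1
  have hvU : v ∈ U := by
    refine ⟨hvm, fun X hX => ?_⟩
    filter_upwards [ae_all_iff.2 fun n => (huU n).2 X hX] with ω hω
    exact le_iInf hω
  have hv : ∫⁻ ω, f (v ω) ∂P ≤ sInf ((fun u => ∫⁻ ω, f (u ω) ∂P) '' U) := by
    refine ge_of_tendsto' ha fun n => ?_
    rw [← hua n]
    exact lintegral_mono fun ω => hf.monotone (iInf_le _ n)
  refine ⟨v, hvm, hvU.2, fun w hwm hw => ?_⟩
  have hmin : (fun ω => v ω ⊓ w ω) ∈ U := by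
    refine ⟨hvm.inf hwm, fun X hX => ?_⟩
    filter_upwards [hvU.2 X hX, hw X hX] with ω h1 h2
    exact le_inf h1 h2
  have hle : ∫⁻ ω, f (v ω) ∂P ≤ ∫⁻ ω, f (v ω ⊓ w ω) ∂P :=
    hv.trans (sInf_le ⟨_, hmin, rfl⟩)
  have hfin : ∫⁻ ω, f (v ω ⊓ w ω) ∂P ≠ ∞ := by
    refine ne_top_of_le_ne_top (measure_ne_top P Set.univ) ?_
    simpa using lintegral_mono (μ := P) fun ω => hf1 (v ω ⊓ w ω)
  have hae := ae_eq_of_ae_le_of_lintegral_le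
    (Eventually.of_forall fun ω => hf.monotone (inf_le_left : v ω ⊓ w ω ≤ v ω)) hfin
    (hfm.comp (hvm.mono hm le_rfl)).aemeasurable hle
  filter_upwards [hae] with ω hω
  exact inf_eq_left.1 (hf.injective hω)

/-- Conditional essential infima exist, for every family and every sub-σ-algebra. -/
theorem exists_isCondEssInf {Ω : Type*} {m mΩ : MeasurableSpace Ω}
    (hm : m ≤ mΩ) (P : Measure Ω) [IsFiniteMeasure P] (𝒳 : Set (Ω → EReal)) :
    ∃ Z : Ω → EReal, IsCondEssInf m P 𝒳 Z := by
  obtain ⟨Z, hZ, h1, h2⟩ := exists_isCondEssSup hm P ((fun X ω => -X ω) '' 𝒳)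
  refine ⟨fun ω => -Z ω, ?_, fun X hX => ?_, fun Z' hZ' h => ?_⟩
  · exact (measurable_neg (G := EReal)).comp hZ
  · filter_upwards [h1 _ ⟨X, hX, rfl⟩] with ω hω
    exact EReal.neg_le_of_neg_le hω
  · have := h2 (fun ω => -Z' ω) ((measurable_neg (G := EReal)).comp hZ') (by
      rintro _ ⟨X, hX, rfl⟩
      filter_upwards [h X hX] with ω hω
      exact EReal.neg_le_neg_iff.2 hω)
    filter_upwards [this] with ω hω
    exact EReal.le_neg_of_le_neg hω

open Classical in
/-- The conditional essential supremum (a version of it; the value `0` is used only when none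
exists, which does not happen for a finite measure, see `exists_isCondEssSup`). -/
def condEssSup {Ω : Type*} (m : MeasurableSpace Ω) {_mΩ : MeasurableSpace Ω} (P : Measure Ω)
    (𝒳 : Set (Ω → EReal)) : Ω → EReal :=
  if h : ∃ Z, IsCondEssSup m P 𝒳 Z then h.choose else 0

open Classical in
/-- The conditional essential infimum (a version of it; the value `0` is used only when none
exists, which does not happen for a finite measure, see `exists_isCondEssInf`). -/
def condEssInf {Ω : Type*} (m : MeasurableSpace Ω) {_mΩ : MeasurableSpace Ω} (P : Measure Ω)
    (𝒳 : Set (Ω → EReal)) : Ω → EReal :=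
  if h : ∃ Z, IsCondEssInf m P 𝒳 Z then h.choose else 0

theorem isCondEssSup_condEssSup {Ω : Type*} {m mΩ : MeasurableSpace Ω}
    (hm : m ≤ mΩ) (P : Measure Ω) [IsFiniteMeasure P] (𝒳 : Set (Ω → EReal)) :
    IsCondEssSup m P 𝒳 (condEssSup m P 𝒳) := by
  have h := exists_isCondEssSup hm P 𝒳
  rw [condEssSup, dif_pos h]
  exact h.choose_spec

theorem isCondEssInf_condEssInf {Ω : Type*} {m mΩ : MeasurableSpace Ω}
    (hm : m ≤ mΩ) (P : Measure Ω) [IsFiniteMeasure P] (𝒳 : Set (Ω → EReal)) :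
    IsCondEssInf m P 𝒳 (condEssInf m P 𝒳) := by
  have h := exists_isCondEssInf hm P 𝒳
  rw [condEssInf, dif_pos h]
  exact h.choose_spec

/-! ### Random closed sets, conditional supports, normal integrands -/

/-- A closed-valued random set whose graph belongs to `m ⊗ 𝓑(E)`. -/
def IsRandomClosedSet {Ω E : Type*} [TopologicalSpace E] [MeasurableSpace E]
    (m : MeasurableSpace Ω) (K : Ω → Set E) : Prop :=
  (∀ ω, IsClosed (K ω)) ∧
    MeasurableSet[m.prod inferInstance] {p : Ω × E | p.2 ∈ K p.1}

/-- `K` is the conditional support of `X` given `m`: the smallest `m`-measurable random closed set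
that contains `X` a.s. -/
def IsCondSupport {Ω E : Type*} [TopologicalSpace E] [MeasurableSpace E]
    (m : MeasurableSpace Ω) {_mΩ : MeasurableSpace Ω} (P : Measure Ω) (X : Ω → E) (K : Ω → Set E) : Prop :=
  IsRandomClosedSet m K ∧ (∀ᵐ ω ∂P, X ω ∈ K ω) ∧
    ∀ K' : Ω → Set E, IsRandomClosedSet m K' → (∀ᵐ ω ∂P, X ω ∈ K' ω) → ∀ᵐ ω ∂P, K ω ⊆ K' ω

/-- `f : Ω × E → ℝ` is an `m`-normal integrand: jointly measurable and lower semicontinuous in the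
second variable. -/
def IsNormalIntegrand {Ω E : Type*} [TopologicalSpace E] [MeasurableSpace E]
    (m : MeasurableSpace Ω) (f : Ω → E → ℝ) : Prop :=
  Measurable[m.prod inferInstance] (fun p : Ω × E => f p.1 p.2) ∧
    ∀ ω, LowerSemicontinuous (f ω)

/-! ### The financial market -/

/-- The vector `e₁ = (1, 0, …, 0)`. -/
def cashUnit (d : ℕ) [NeZero d] : Fin d → ℝ := Pi.single 0 1

/-- `risky z = (0, z⁽²⁾)`: the position `z = (z¹, z⁽²⁾)` with its cash component removed. -/
def risky {d : ℕ} [NeZero d] (z : Fin d → ℝ) : Fin d → ℝ := Function.update z 0 0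

/-- The standing assumptions on the market with horizon `T`, given by the deterministic cost
functions `C t s z` (the cash needed at time `t` to buy the position `z` when the market data are
`s`) and by the market data process `S t` with values in the nonnegative orthant. -/
structure IsMarket {Ω : Type*} {mΩ : MeasurableSpace Ω} (P : Measure Ω) (F : Filtration ℕ mΩ)
    (T : ℕ) {d k : ℕ} [NeZero d] (S : ℕ → Ω → (Fin k → ℝ))
    (C : ℕ → (Fin k → ℝ) → (Fin d → ℝ) → ℝ) : Prop where
  /-- the filtration is complete -/
  complete : ∀ A : Set Ω, P A = 0 → MeasurableSet[F 0] A
  adapted : ∀ t ≤ T, Measurable[F t] (S t)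
  nonneg : ∀ t ≤ T, ∀ᵐ ω ∂P, 0 ≤ S t ω
  /-- `C t` is Borel and lower semicontinuous in `(s, z)`, i.e. it is a normal integrand -/
  normal : ∀ t ≤ T, IsNormalIntegrand (F t)
    (fun (_ : Ω) (p : (Fin k → ℝ) × (Fin d → ℝ)) => C t p.1 p.2)
  cost_zero : ∀ t ≤ T, ∀ s, 0 ≤ s → C t s 0 = 0
  cash_invariant : ∀ t ≤ T, ∀ s, 0 ≤ s → ∀ (z : Fin d → ℝ) (a : ℝ),
    C t s (z + a • cashUnit d) = C t s z + a
  increasing : ∀ s, 0 ≤ s → ∀ x y : Fin d → ℝ, x ≤ y → C T s x ≤ C T s y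
  bounded : ∀ t ≤ T, ∃ h : (Fin k → ℝ) × (Fin d → ℝ) → ℝ, Continuous h ∧
    ∀ s, 0 ≤ s → ∀ z, |C t s z| ≤ h (s, z)

/-- Positive super `δ`-homogeneity; an order isomorphism of `[0, ∞]` is the same as an increasing
bijection. -/
def IsSuperHomogeneous {d k : ℕ} (δ : ℝ≥0∞ ≃o ℝ≥0∞)
    (c : (Fin k → ℝ) → (Fin d → ℝ) → ℝ) : Prop :=
  ∀ a : ℝ, 1 ≤ a → ∀ s, 0 ≤ s → ∀ z, (δ (ENNReal.ofReal a)).toReal * c s z ≤ c s (a • z)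

def IsSubAdditive {d k : ℕ} (c : (Fin k → ℝ) → (Fin d → ℝ) → ℝ) : Prop :=
  ∀ s, 0 ≤ s → ∀ x y, c s (x + y) ≤ c s x + c s y

def IsSuperAdditive {d k : ℕ} (c : (Fin k → ℝ) → (Fin d → ℝ) → ℝ) : Prop :=
  ∀ s, 0 ≤ s → ∀ x y, c s x + c s y ≤ c s (x + y)

/-- The solvency set `G_t = {z : L_t(z) ≥ 0}`, with the liquidation value
`L_t(z) = -C_t(S_t, -z)`. -/
def solvencySet {Ω : Type*} {d k : ℕ} (S : ℕ → Ω → (Fin k → ℝ))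
    (C : ℕ → (Fin k → ℝ) → (Fin d → ℝ) → ℝ) (t : ℕ) (ω : Ω) : Set (Fin d → ℝ) :=
  {z | 0 ≤ -C t (S t ω) (-z)}

/-- `ξ` is the terminal value of a portfolio process `(V_u)_{u=0}^T`, i.e. of an adapted process
with `V_u - V_{u-1} ∈ -G_u` a.s. -/
def IsHedgeable {Ω : Type*} {mΩ : MeasurableSpace Ω} (P : Measure Ω) (F : Filtration ℕ mΩ)
    (T : ℕ) {d k : ℕ} (S : ℕ → Ω → (Fin k → ℝ)) (C : ℕ → (Fin k → ℝ) → (Fin d → ℝ) → ℝ)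
    (ξ : Ω → (Fin d → ℝ)) : Prop :=
  ∃ V : ℕ → Ω → (Fin d → ℝ), (∀ u ≤ T, Measurable[F u] (V u)) ∧
    (∀ u < T, ∀ᵐ ω ∂P, -(V (u + 1) ω - V u ω) ∈ solvencySet S C (u + 1) ω) ∧
    V T =ᵐ[P] ξ

/-! ### Hedging costs -/

/-- Admissible strategies from time `t` on: `W u`, `t ≤ u < T`, is the `F u`-measurable position
held after trading at time `u` and `W T = ξ`. Only the risky parts `risky (W u)` enter the
costs below. -/
def IsStrategy {Ω : Type*} {mΩ : MeasurableSpace Ω} (F : Filtration ℕ mΩ) (T : ℕ) {d : ℕ}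
    (ξ : Ω → (Fin d → ℝ)) (t : ℕ) (W : ℕ → Ω → (Fin d → ℝ)) : Prop :=
  (∀ u, t ≤ u → u < T → Measurable[F u] (W u)) ∧ W T = ξ

/-- `ξ¹ + ∑_{u=t}^T C_u(S_u, (0, W_u⁽²⁾ - W_{u-1}⁽²⁾))`, where `W_{t-1} = v` is the position held
before time `t`. -/
def strategyCost {Ω : Type*} (T : ℕ) {d k : ℕ} [NeZero d] (S : ℕ → Ω → (Fin k → ℝ))
    (C : ℕ → (Fin k → ℝ) → (Fin d → ℝ) → ℝ) (ξ : Ω → (Fin d → ℝ)) (t : ℕ)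
    (v : Ω → (Fin d → ℝ)) (W : ℕ → Ω → (Fin d → ℝ)) (ω : Ω) : ℝ :=
  ξ ω 0 + ∑ u ∈ Finset.Icc t T,
    C u (S u ω) (risky (W u ω - if u = t then v ω else W (u - 1) ω))

/-- The `F t`-conditional superhedging cost `esssup_{F_t} (ξ¹ + ∑_{u=t}^T C_u(…))` of a strategy. -/
def condStrategyCost {Ω : Type*} {mΩ : MeasurableSpace Ω} (P : Measure Ω) (F : Filtration ℕ mΩ)
    (T : ℕ) {d k : ℕ} [NeZero d] (S : ℕ → Ω → (Fin k → ℝ))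
    (C : ℕ → (Fin k → ℝ) → (Fin d → ℝ) → ℝ) (ξ : Ω → (Fin d → ℝ)) (t : ℕ)
    (v : Ω → (Fin d → ℝ)) (W : ℕ → Ω → (Fin d → ℝ)) : Ω → EReal :=
  condEssSup (F t) P {fun ω => (strategyCost T S C ξ t v W ω : EReal)}

/-- The infimum hedging cost `γ_t^ξ(v)`. -/
def hedgingCost {Ω : Type*} {mΩ : MeasurableSpace Ω} (P : Measure Ω) (F : Filtration ℕ mΩ)
    (T : ℕ) {d k : ℕ} [NeZero d] (S : ℕ → Ω → (Fin k → ℝ))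
    (C : ℕ → (Fin k → ℝ) → (Fin d → ℝ) → ℝ) (ξ : Ω → (Fin d → ℝ)) (t : ℕ)
    (v : Ω → (Fin d → ℝ)) : Ω → EReal :=
  condEssInf (F t) P
    {X | ∃ W, IsStrategy F T ξ t W ∧ X = condStrategyCost P F T S C ξ t v W}

/-- `D_t^ξ(S_t, v, Z) = C_t(S_t, (0, Z⁽²⁾ - v⁽²⁾)) + esssup_{F_t} γ_{t+1}^ξ(Z)`. -/
def oneStepCost {Ω : Type*} {mΩ : MeasurableSpace Ω} (P : Measure Ω) (F : Filtration ℕ mΩ)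
    (T : ℕ) {d k : ℕ} [NeZero d] (S : ℕ → Ω → (Fin k → ℝ))
    (C : ℕ → (Fin k → ℝ) → (Fin d → ℝ) → ℝ) (ξ : Ω → (Fin d → ℝ)) (t : ℕ)
    (v Z : Ω → (Fin d → ℝ)) (ω : Ω) : EReal :=
  (C t (S t ω) (risky (Z ω - v ω)) : EReal) +
    condEssSup (F t) P {hedgingCost P F T S C ξ (t + 1) Z} ω

/-- Condition SAIP: at every time `t ≤ T` the minimal cost `γ_t^0(0)` of the zero claim is `0`
(condition AIP) and, for `t < T`, the cost `D_t^0(S_t, 0, Z)` vanishes only for `Z⁽²⁾ = 0`. -/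
def SAIP {Ω : Type*} {mΩ : MeasurableSpace Ω} (P : Measure Ω) (F : Filtration ℕ mΩ)
    (T : ℕ) {d k : ℕ} [NeZero d] (S : ℕ → Ω → (Fin k → ℝ))
    (C : ℕ → (Fin k → ℝ) → (Fin d → ℝ) → ℝ) : Prop :=
  (∀ t ≤ T, hedgingCost P F T S C 0 t 0 =ᵐ[P] 0) ∧
    ∀ t < T, ∀ Z : Ω → (Fin d → ℝ), Measurable[F t] Z →
      (oneStepCost P F T S C 0 t 0 Z =ᵐ[P] 0 ↔ (fun ω => risky (Z ω)) =ᵐ[P] 0)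

/-- The assumption on the conditional supports: `supp_{F_t} S_{t+1} = φ_t(S_t)` for a lower
hemicontinuous compact-valued `φ_t` with `φ_t(S_t)` in a closed ball whose radius is a continuous
function of `S_t` (the choice of the norm is immaterial here). -/
def HasMarkovSupport {Ω : Type*} {mΩ : MeasurableSpace Ω} (P : Measure Ω) (F : Filtration ℕ mΩ)
    (T : ℕ) {k : ℕ} (S : ℕ → Ω → (Fin k → ℝ)) (φ : ℕ → (Fin k → ℝ) → Set (Fin k → ℝ)) : Prop :=
  ∀ t < T, LowerHemicontinuous (φ t) ∧ (∀ s, IsCompact (φ t s)) ∧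
    IsCondSupport (F t) P (S (t + 1)) (fun ω => φ t (S t ω)) ∧
    ∃ R : (Fin k → ℝ) → ℝ, Continuous R ∧
      ∀ᵐ ω ∂P, φ t (S t ω) ⊆ Metric.closedBall 0 (R (S t ω))

end

/-! The proof is a backward dynamic programming recursion. At time `T` the value is `terminalCost`.
One step back, `stepCost` adds to the trading cost the supremum of the next value over `φ t s`. This
supremum is the conditional essential supremum, because an `F t`-measurable bound on a lower
semicontinuous function of `S (t + 1)` extends to the whole conditional support. It is again lower
semicontinuous because `φ t` is lower hemicontinuous.

The difficulty is minimising over the noncompact set of positions. Under SAIP the zero claim has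
strictly positive step cost at every nonzero risky position. By semicontinuity and compactness this
cost is at least some `ε > 0` on the unit sphere of risky positions, uniformly for nearby `s`.
Super-homogeneity then makes the cost of `y` at least `δ ‖y‖ * ε`, and `δ` is unbounded. Comparison
of the claim with the zero claim, together with sub- or super-additivity to change the starting
position, carries this coercivity over to the claim (`eventually_norm_le_of_stepCost_le`).
Near-minimisers thus stay in a ball locally uniformly: the infimum is attained, has a measurable
minimiser, and is lower semicontinuous along the no-arbitrage set.

SAIP, however, only speaks almost surely, so positivity is known only on a set `noArbitrageSet` that
contains `S t` almost surely, whereas the value function must be defined everywhere. It is therefore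
extended by lower limits along that set, capped by a continuous majorant. The properties used in the
recursion (`IsValuePair`) survive these limits on the closure, hence on the support of the law of `S
t`; and `φ t` maps this support into subsets of the support of the law of `S (t + 1)`. The zero
claim is carried along with the claim because homogeneity and SAIP concern only the former. -/

noncomputable section

/-! ### Measurable selections of compact-valued multifunctions -/

/-- A measurable compact-valued multifunction has, for every finite set of coordinates, a
measurable compact-valued refinement on whose values these coordinates are constant. -/
theorem exists_refinement_of_isCompact {Ω ι : Type*} {_ : MeasurableSpace Ω} [Fintype ι]
    (M : Ω → Set (ι → ℝ)) (hc : ∀ ω, IsCompact (M ω)) (hne : ∀ ω, (M ω).Nonempty)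
    (hm : ∀ B, IsClosed B → MeasurableSet {ω | (M ω ∩ B).Nonempty}) (s : Finset ι) :
    ∃ M' : Ω → Set (ι → ℝ), (∀ ω, M' ω ⊆ M ω) ∧ (∀ ω, IsCompact (M' ω)) ∧
      (∀ ω, (M' ω).Nonempty) ∧ (∀ B, IsClosed B → MeasurableSet {ω | (M' ω ∩ B).Nonempty}) ∧
      ∀ ω, ∀ i ∈ s, ∀ x ∈ M' ω, ∀ y ∈ M' ω, x i = y i := by
  classical
  induction s using Finset.induction_on with
  | empty => exact ⟨M, fun _ => subset_rfl, hc, hne, hm, by simp⟩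
  | insert i s _ ih =>
    obtain ⟨M', hsub, hc', hne', hm', heq⟩ := ih
    have hcont : Continuous fun x : ι → ℝ => x i := continuous_apply i
    have hcl : ∀ q : ℝ, IsClosed {x : ι → ℝ | x i ≤ q} := fun q =>
      isClosed_le hcont continuous_const
    have hmin : ∀ ω, ∃ z ∈ M' ω, ∀ y ∈ M' ω, z i ≤ y i := fun ω =>
      (hc' ω).exists_isMinOn (hne' ω) hcont.continuousOn
    -- Lexicographic minimisation: keep only the points with minimal `i`-th coordinate.
    refine ⟨fun ω => {x | x ∈ M' ω ∧ ∀ y ∈ M' ω, x i ≤ y i}, fun ω x hx => hsub ω hx.1,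
      fun ω => ?_, fun ω => ?_, fun B hB => ?_, fun ω j hj x hx y hy => ?_⟩
    · obtain ⟨z, hz, hzm⟩ := hmin ω
      have : {x | x ∈ M' ω ∧ ∀ y ∈ M' ω, x i ≤ y i} = M' ω ∩ {x | x i ≤ z i} := by
        ext x
        exact ⟨fun h => ⟨h.1, h.2 z hz⟩, fun h => ⟨h.1, fun y hy => le_trans h.2 (hzm y hy)⟩⟩
      simpa only [this] using (hc' ω).inter_right (hcl _)
    · obtain ⟨z, hz, hzm⟩ := hmin ω
      exact ⟨z, hz, hzm⟩
    -- A minimiser lies in `B` iff the minimum over `M' ω ∩ B` does not exceed that over `M' ω`;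
    -- rational thresholds test this countably.
    · have : {ω | ({x | x ∈ M' ω ∧ ∀ y ∈ M' ω, x i ≤ y i} ∩ B).Nonempty} =
          {ω | (M' ω ∩ B).Nonempty} ∩ ⋂ q : ℚ, ({ω | (M' ω ∩ {x | x i ≤ (q : ℝ)}).Nonempty}ᶜ ∪
            {ω | (M' ω ∩ (B ∩ {x | x i ≤ (q : ℝ)})).Nonempty}) := by
        ext ω
        constructor
        · rintro ⟨x, ⟨hx, hxm⟩, hxB⟩
          refine ⟨⟨x, hx, hxB⟩, Set.mem_iInter.2 fun q => ?_⟩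
          by_cases h : (M' ω ∩ {x | x i ≤ (q : ℝ)}).Nonempty
          · obtain ⟨y, hy, hyq⟩ := h
            exact Or.inr ⟨x, hx, hxB, (hxm y hy).trans hyq⟩
          · exact Or.inl h
        · rintro ⟨h1, h2⟩
          obtain ⟨x, hx, hxm⟩ := ((hc' ω).inter_right hB).exists_isMinOn h1 hcont.continuousOn
          refine ⟨x, ⟨hx.1, fun y hy => ?_⟩, hx.2⟩
          by_contra hlt
          obtain ⟨q, hq1, hq2⟩ := exists_rat_btwn (not_le.1 hlt)
          rcases Set.mem_iInter.1 h2 q with h | h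
          · exact h ⟨y, hy, hq1.le⟩
          · obtain ⟨x', hx', hx'B, hx'q⟩ := h
            have h3 : x i ≤ x' i := hxm ⟨hx', hx'B⟩
            exact absurd (h3.trans hx'q) (not_le.2 hq2)
      rw [this]
      exact (hm' B hB).inter (MeasurableSet.iInter fun q =>
        (hm' _ (hcl _)).compl.union (hm' _ (hB.inter (hcl _))))
    · rcases Finset.mem_insert.1 hj with rfl | hj
      · exact le_antisymm (hx.2 y hy.1) (hy.2 x hx.1)
      · exact heq ω j hj x hx.1 y hy.1

/-- A measurable multifunction with nonempty compact values in `ℝⁿ` has a measurable selection. -/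
theorem exists_measurable_selection {Ω ι : Type*} {_ : MeasurableSpace Ω} [Fintype ι]
    (M : Ω → Set (ι → ℝ)) (hc : ∀ ω, IsCompact (M ω)) (hne : ∀ ω, (M ω).Nonempty)
    (hm : ∀ B, IsClosed B → MeasurableSet {ω | (M ω ∩ B).Nonempty}) :
    ∃ Y : Ω → ι → ℝ, Measurable Y ∧ ∀ ω, Y ω ∈ M ω := by
  obtain ⟨M', hsub, -, hne', hm', heq⟩ := exists_refinement_of_isCompact M hc hne hm Finset.univ
  choose Y hY using hne'
  refine ⟨Y, measurable_of_isClosed fun B hB => ?_, fun ω => hsub ω (hY ω)⟩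
  -- With all coordinates fixed the refined values are singletons, so preimages under `Y` are
  -- hitting sets.
  have : Y ⁻¹' B = {ω | (M' ω ∩ B).Nonempty} := by
    ext ω
    refine ⟨fun h => ⟨Y ω, hY ω, h⟩, ?_⟩
    rintro ⟨x, hx, hxB⟩
    have : x = Y ω := funext fun i => heq ω i (Finset.mem_univ i) x hx _ (hY ω)
    rw [this] at hxB
    exact hxB
  rw [this]
  exact hm' B hB

/-! ### Semicontinuity of partial infima and suprema -/

/-- Compactness of `K` gives a neighbourhood of `x` that serves all `y ∈ K` at once; the
intermediate level `c'` is needed because an infimum preserves only weak inequalities. -/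
theorem LowerSemicontinuous.iInf_of_isCompact {E G : Type*} [TopologicalSpace E]
    [TopologicalSpace G] {D : E × G → EReal} (hD : LowerSemicontinuous D) {K : Set G}
    (hK : IsCompact K) : LowerSemicontinuous fun x => ⨅ y ∈ K, D (x, y) := by
  intro x c hc
  obtain ⟨c', hc1, hc2⟩ := exists_between hc
  have : ∀ᶠ x' in 𝓝 x, ∀ y ∈ K, c' < D (x', y) := by
    refine hK.eventually_forall_of_forall_eventually fun y hy => ?_
    exact hD (x, y) c' (hc2.trans_le (iInf₂_le y hy))
  filter_upwards [this] with x' hx'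
  exact hc1.trans_le (le_iInf₂ fun y hy => (hx' y hy).le)

/-- The minimum is attained. This turns the existence of a point in a level set into an inequality
between measurable functions. -/
theorem LowerSemicontinuous.iInf_le_iff_of_isCompact {E G : Type*} [TopologicalSpace E]
    [TopologicalSpace G] {D : E × G → EReal} (hD : LowerSemicontinuous D) {K : Set G}
    (hK : IsCompact K) (x : E) (c : ℝ) :
    ⨅ y ∈ K, D (x, y) ≤ (c : EReal) ↔ ∃ y ∈ K, D (x, y) ≤ (c : EReal) := by
  constructor
  · intro h
    rcases K.eq_empty_or_nonempty with rfl | hne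
    · simp at h
    · have hl : LowerSemicontinuousOn (fun y => D (x, y)) K :=
        (hD.comp (Continuous.prodMk_right x)).lowerSemicontinuousOn K
      obtain ⟨y, hy, hmin⟩ := hl.exists_isMinOn hne hK
      exact ⟨y, hy, (le_iInf₂ fun z hz => hmin hz).trans h⟩
  · rintro ⟨y, hy, h⟩
    exact (iInf₂_le y hy).trans h

/-- Measurable selection from the level sets of a lower semicontinuous function. -/
theorem LowerSemicontinuous.exists_measurable_sublevel_selection {Ω E ι : Type*}
    {_ : MeasurableSpace Ω} [Fintype ι]
    [TopologicalSpace E] [MeasurableSpace E] [OpensMeasurableSpace E] {D : E × (ι → ℝ) → EReal}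
    (hD : LowerSemicontinuous D) {x : Ω → E} (hx : Measurable x) {c : E → ℝ} (hc : Measurable c)
    {B₀ : Set (ι → ℝ)} (hB₀ : IsClosed B₀) {G : Set Ω} (hG : MeasurableSet G)
    (hne : ∀ ω ∈ G, ∃ y ∈ B₀, D (x ω, y) ≤ c (x ω))
    (hbdd : ∀ ω ∈ G, ∃ r : ℝ, ∀ y ∈ B₀, D (x ω, y) ≤ c (x ω) → ‖y‖ ≤ r) :
    ∃ Y : Ω → ι → ℝ, Measurable Y ∧ (∀ ω ∈ G, Y ω ∈ B₀ ∧ D (x ω, Y ω) ≤ c (x ω)) ∧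
      ∀ ω ∉ G, Y ω = 0 := by
  have hcl : ∀ e, IsClosed {y | D (e, y) ≤ c e} := fun e =>
    (hD.comp (Continuous.prodMk_right e)).isClosed_preimage (c e : EReal)
  obtain ⟨Y, hY, hYM⟩ := exists_measurable_selection
    -- Off `G` the value is `{0}`, so that all values are nonempty and compact.
    (fun ω => {y | (ω ∈ G ∧ y ∈ B₀ ∧ D (x ω, y) ≤ c (x ω)) ∨ (ω ∉ G ∧ y = 0)})
    (fun ω => by
      by_cases h : ω ∈ G
      · obtain ⟨r, hr⟩ := hbdd ω h
        have : {y | (ω ∈ G ∧ y ∈ B₀ ∧ D (x ω, y) ≤ c (x ω)) ∨ (ω ∉ G ∧ y = 0)} =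
            B₀ ∩ {y | D (x ω, y) ≤ c (x ω)} := by ext y; simp [h]
        rw [this]
        refine Metric.isCompact_of_isClosed_isBounded (hB₀.inter (hcl _)) ?_
        refine (Metric.isBounded_closedBall (x := (0 : ι → ℝ)) (r := r)).subset fun y hy => ?_
        simpa using hr y hy.1 hy.2
      · simp [h])
    (fun ω => by
      by_cases h : ω ∈ G
      · obtain ⟨y, hy1, hy2⟩ := hne ω h
        exact ⟨y, Or.inl ⟨h, hy1, hy2⟩⟩
      · exact ⟨0, Or.inr ⟨h, rfl⟩⟩)
    (fun B hB => by
      -- `B ∩ B₀` is cut into compact pieces, on which infima are attained and depend measurably on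
      -- the parameter.
      let J : ℕ → E → EReal := fun n e =>
        ⨅ y ∈ B ∩ B₀ ∩ Metric.closedBall (0 : ι → ℝ) n, D (e, y)
      have hK : ∀ n : ℕ, IsCompact (B ∩ B₀ ∩ Metric.closedBall (0 : ι → ℝ) n) := fun n =>
        (isCompact_closedBall _ _).inter_left (hB.inter hB₀)
      have hJ : ∀ n, Measurable (J n) := fun n => (hD.iInf_of_isCompact (hK n)).measurable
      have : {ω | ({y | (ω ∈ G ∧ y ∈ B₀ ∧ D (x ω, y) ≤ c (x ω)) ∨ (ω ∉ G ∧ y = 0)} ∩ B).Nonempty}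
          = (G ∩ ⋃ n : ℕ, {ω | J n (x ω) ≤ (c (x ω) : EReal)}) ∪ (Gᶜ ∩ {_ω | (0 : ι → ℝ) ∈ B}) := by
        ext ω
        constructor
        · rintro ⟨y, ⟨h1, h2, h3⟩ | ⟨h1, rfl⟩, hyB⟩
          · obtain ⟨n, hn⟩ := exists_nat_ge ‖y‖
            refine Or.inl ⟨h1, Set.mem_iUnion.2 ⟨n, ?_⟩⟩
            exact (hD.iInf_le_iff_of_isCompact (hK n) _ _).2 ⟨y, ⟨⟨hyB, h2⟩, by simpa using hn⟩, h3⟩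
          · exact Or.inr ⟨h1, hyB⟩
        · rintro (⟨h1, h2⟩ | ⟨h1, h2⟩)
          · obtain ⟨n, hn⟩ := Set.mem_iUnion.1 h2
            obtain ⟨y, hy, hyc⟩ := (hD.iInf_le_iff_of_isCompact (hK n) _ _).1 hn
            exact ⟨y, Or.inl ⟨h1, hy.1.2, hyc⟩, hy.1.1⟩
          · exact ⟨0, Or.inr ⟨h1, rfl⟩, h2⟩
      rw [this]
      refine (hG.inter (MeasurableSet.iUnion fun n => ?_)).union
        (hG.compl.inter (MeasurableSet.const _))
      exact measurableSet_le ((hJ n).comp hx) (measurable_coe_real_ereal.comp (hc.comp hx)))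
  refine ⟨Y, hY, fun ω h => ?_, fun ω h => ?_⟩
  · rcases hYM ω with h' | h'
    · exact h'.2
    · exact absurd h h'.1
  · rcases hYM ω with h' | h'
    · exact absurd h'.1 h
    · exact h'.2

/-- A point `s ∈ φ e` with `f s z > c` has a neighbourhood where this persists, and the sets `φ e'`
for nearby `e'` still meet that neighbourhood. -/
theorem LowerHemicontinuous.lowerSemicontinuous_iSup {E G Z : Type*} [TopologicalSpace E]
    [TopologicalSpace G] [TopologicalSpace Z] {φ : E → Set G} (hφ : LowerHemicontinuous φ)
    {f : G → Z → ℝ} (hf : LowerSemicontinuous fun p : G × Z => f p.1 p.2) :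
    LowerSemicontinuous fun p : E × Z => ⨆ s ∈ φ p.1, (f s p.2 : EReal) := by
  rintro ⟨e, z⟩ c hc
  obtain ⟨s, hs, hcs⟩ : ∃ s, ∃ _ : s ∈ φ e, c < (f s z : EReal) := by
    simpa only [lt_iSup_iff] using hc
  have h1 : ∀ᶠ p : G × Z in 𝓝 (s, z), c < (f p.1 p.2 : EReal) :=
    (continuous_coe_real_ereal.comp_lowerSemicontinuous hf
      EReal.coe_strictMono.monotone) (s, z) c hcs
  rw [nhds_prod_eq] at h1
  obtain ⟨U, hU, W, hW, hUW⟩ := Filter.mem_prod_iff.1 h1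
  obtain ⟨U', hU', hUo, hsU⟩ := mem_nhds_iff.1 hU
  have h2 := (lowerHemicontinuous_iff_isOpen_inter_nonempty.1 hφ U' hUo).mem_nhds
    (show e ∈ _ from ⟨s, hs, hsU⟩)
  rw [nhds_prod_eq]
  filter_upwards [Filter.prod_mem_prod h2 hW] with p hp
  obtain ⟨s', hs', hsU'⟩ := hp.1
  exact (hUW (show (s', p.2) ∈ U ×ˢ W from ⟨hU' hsU', hp.2⟩) : c < (f s' p.2 : EReal)).trans_le
    (le_iSup₂ (f := fun s (_ : s ∈ φ p.1) => (f s p.2 : EReal)) s' hs')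

/-! ### Lower semicontinuous extensions -/

/-- The extension of `f`, given on `A`, by its lower limits along `A`, capped by `H`. -/
def lscExtension {E : Type*} [TopologicalSpace E] (A : Set E) (f : E → EReal) (H : E → ℝ)
    (x : E) : ℝ :=
  (liminf f (𝓝[A] x) ⊓ (H x : EReal)).toReal

section lscExtension

variable {E : Type*} [TopologicalSpace E] {A : Set E} {f : E → EReal} {H L : E → ℝ}

theorem le_liminf_nhdsWithin (hL : Continuous L) (hf : ∀ a ∈ A, (L a : EReal) ≤ f a) (x : E) :
    (L x : EReal) ≤ liminf f (𝓝[A] x) := by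
  refine le_of_forall_lt fun c hc => ?_
  obtain ⟨c', h1, h2⟩ := exists_between hc
  refine h1.trans_le (le_liminf_of_le (by isBoundedDefault) ?_)
  have : ∀ᶠ a in 𝓝[A] x, c' < (L a : EReal) :=
    ((continuous_coe_real_ereal.comp hL).continuousAt.mono_left
      nhdsWithin_le_nhds).eventually_const_lt h2
  filter_upwards [this, self_mem_nhdsWithin] with a ha haA
  exact ha.le.trans (hf a haA)

theorem liminf_nhdsWithin_le (hH : Continuous H) (hf : ∀ a ∈ A, f a ≤ (H a : EReal)) {x : E}
    (hx : x ∈ closure A) : liminf f (𝓝[A] x) ≤ (H x : EReal) := by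
  have : (𝓝[A] x).NeBot := mem_closure_iff_nhdsWithin_neBot.1 hx
  have h1 : Tendsto (fun a => (H a : EReal)) (𝓝[A] x) (𝓝 (H x : EReal)) :=
    (continuous_coe_real_ereal.comp hH).continuousAt.mono_left nhdsWithin_le_nhds
  rw [← h1.liminf_eq]
  refine liminf_le_liminf ?_
  filter_upwards [self_mem_nhdsWithin] with a ha using hf a ha

theorem lowerSemicontinuous_liminf_nhdsWithin (A : Set E) (f : E → EReal) :
    LowerSemicontinuous fun x => liminf f (𝓝[A] x) := by
  intro x c hc
  obtain ⟨c', h1, h2⟩ := exists_between hc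
  filter_upwards [eventually_nhds_nhdsWithin.2 (eventually_lt_of_lt_liminf h2)] with y hy
  exact h1.trans_le (le_liminf_of_le (by isBoundedDefault) (hy.mono fun a ha => ha.le))

/-- `toReal` loses nothing here: `L` excludes `⊥`, and the cap excludes `⊤`, which is the value of
the lower limit off the closure of `A`. -/
theorem coe_lscExtension (hL : Continuous L) (hf : ∀ a ∈ A, (L a : EReal) ≤ f a) (x : E) :
    (lscExtension A f H x : EReal) = liminf f (𝓝[A] x) ⊓ (H x : EReal) := by
  refine EReal.coe_toReal (ne_top_of_le_ne_top (EReal.coe_ne_top _) inf_le_right) ?_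
  refine ne_bot_of_le_ne_bot (EReal.coe_ne_bot (L x ⊓ H x)) ?_
  refine le_inf ((EReal.coe_le_coe_iff.2 inf_le_left).trans (le_liminf_nhdsWithin hL hf x))
    (EReal.coe_le_coe_iff.2 inf_le_right)

theorem lowerSemicontinuous_lscExtension (hL : Continuous L) (hH : Continuous H)
    (hf : ∀ a ∈ A, (L a : EReal) ≤ f a) : LowerSemicontinuous (lscExtension A f H) := by
  have h : LowerSemicontinuous fun x => liminf f (𝓝[A] x) ⊓ (H x : EReal) :=
    (lowerSemicontinuous_liminf_nhdsWithin A f).inf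
      (continuous_coe_real_ereal.comp hH).lowerSemicontinuous
  intro x c hc
  simp only [← coe_lscExtension hL hf] at h
  filter_upwards [h x c (EReal.coe_lt_coe_iff.2 hc)] with y hy
  exact EReal.coe_lt_coe_iff.1 hy

theorem lscExtension_le (hL : Continuous L) (hf : ∀ a ∈ A, (L a : EReal) ≤ f a) (x : E) :
    lscExtension A f H x ≤ H x := by
  have := coe_lscExtension (H := H) hL hf x
  exact EReal.coe_le_coe_iff.1 (this.trans_le inf_le_right)

theorem coe_lscExtension_of_mem_closure (hL : Continuous L) (hH : Continuous H)
    (hf : ∀ a ∈ A, (L a : EReal) ≤ f a) (hf' : ∀ a ∈ A, f a ≤ (H a : EReal)) {x : E}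
    (hx : x ∈ closure A) : (lscExtension A f H x : EReal) = liminf f (𝓝[A] x) := by
  rw [coe_lscExtension hL hf, inf_eq_left.2 (liminf_nhdsWithin_le hH hf' hx)]

theorem coe_lscExtension_of_mem (hL : Continuous L) (hH : Continuous H)
    (hf : ∀ a ∈ A, (L a : EReal) ≤ f a) (hf' : ∀ a ∈ A, f a ≤ (H a : EReal)) {x : E}
    (hx : x ∈ A) (hlsc : LowerSemicontinuousWithinAt f A x) :
    (lscExtension A f H x : EReal) = f x := by
  rw [coe_lscExtension_of_mem_closure hL hH hf hf' (subset_closure hx)]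
  refine le_antisymm ?_ (lowerSemicontinuousWithinAt_iff_le_liminf.1 hlsc)
  -- Since `x ∈ A`, the filter `𝓝[A] x` contains the point `x` itself, so the lower limit is at most
  -- `f x`.
  refine (liminf_le_liminf_of_le (pure_le_nhdsWithin hx)).trans ?_
  simp [liminf_eq, sSup_le_iff]

end lscExtension

/-! ### Continuous majorants -/

/-- The supremum of a continuous function over closed balls whose radii depend continuously on a
parameter is bounded by a continuous function of the parameter. -/
theorem exists_continuous_bound_on_closedBall {E G : Type*} [TopologicalSpace E]
    [NormedAddCommGroup G] [NormedSpace ℝ G] [ProperSpace G] {R : E → ℝ} (hR : Continuous R)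
    {H : G → ℝ} (hH : Continuous H) :
    ∃ B : E → ℝ, Continuous B ∧ ∀ e, ∀ s ∈ Metric.closedBall (0 : G) (R e), H s ≤ B e := by
  have hc : IsCompact (Metric.closedBall (0 : G) 1) := isCompact_closedBall _ _
  have hcont : Continuous fun p : E × G => H ((|R p.1| + 1) • p.2) := by fun_prop
  -- Rescaling by `|R e| + 1`, which is always positive, replaces the moving ball by the fixed unit
  -- ball.
  refine ⟨fun e => sSup ((fun u => H ((|R e| + 1) • u)) '' Metric.closedBall (0 : G) 1),
    hc.continuous_sSup (f := fun e u => H ((|R e| + 1) • u)) hcont, fun e s hs => ?_⟩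
  have hpos : (0 : ℝ) < |R e| + 1 := by positivity
  refine le_csSup (hc.image (hcont.comp (Continuous.prodMk_right e))).bddAbove
    ⟨(|R e| + 1)⁻¹ • s, ?_, by simp only [smul_smul, mul_inv_cancel₀ hpos.ne', one_smul]⟩
  rw [mem_closedBall_zero_iff] at hs ⊢
  rw [norm_smul, norm_inv, Real.norm_of_nonneg hpos.le, inv_mul_le_iff₀ hpos, mul_one]
  exact hs.trans ((le_abs_self _).trans (by linarith))


/-! ### The risky part of a position -/

section risky

variable {d : ℕ} [NeZero d]

theorem risky_apply_zero (z : Fin d → ℝ) : risky z 0 = 0 := by simp [risky]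

theorem risky_apply_of_ne (z : Fin d → ℝ) {i : Fin d} (hi : i ≠ 0) : risky z i = z i := by
  simp [risky, hi]

theorem risky_eq_self {z : Fin d → ℝ} (hz : z 0 = 0) : risky z = z := by
  rw [risky, ← hz, Function.update_eq_self]

theorem risky_risky (z : Fin d → ℝ) : risky (risky z) = risky z :=
  risky_eq_self (risky_apply_zero z)

theorem risky_zero : risky (0 : Fin d → ℝ) = 0 := risky_eq_self rfl

theorem risky_smul (a : ℝ) (z : Fin d → ℝ) : risky (a • z) = a • risky z := by
  ext i
  by_cases hi : i = 0
  · subst hi; simp [risky_apply_zero]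
  · simp [risky_apply_of_ne _ hi]

theorem risky_add (y z : Fin d → ℝ) : risky (y + z) = risky y + risky z := by
  ext i
  by_cases hi : i = 0
  · subst hi; simp [risky_apply_zero]
  · simp [risky_apply_of_ne _ hi]

theorem risky_neg (z : Fin d → ℝ) : risky (-z) = -risky z := by
  simpa using risky_smul (-1) z

theorem risky_sub (y z : Fin d → ℝ) : risky (y - z) = risky y - risky z := by
  rw [sub_eq_add_neg, risky_add, risky_neg, ← sub_eq_add_neg]

theorem continuous_risky : Continuous (risky : (Fin d → ℝ) → Fin d → ℝ) :=
  continuous_id.update 0 continuous_const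

theorem risky_add_smul_cashUnit (z : Fin d → ℝ) : risky z + z 0 • cashUnit d = z := by
  ext i
  by_cases hi : i = 0
  · subst hi; simp [risky_apply_zero, cashUnit]
  · simp [risky_apply_of_ne _ hi, cashUnit, hi]

end risky

/-! ### One step of the dynamic programming recursion -/

/-- The standing assumptions on a cost function at a fixed date. -/
structure IsCostFunction {d k : ℕ} (δ : ℝ≥0∞ ≃o ℝ≥0∞) (c : (Fin k → ℝ) → (Fin d → ℝ) → ℝ) :
    Prop where
  lsc : LowerSemicontinuous fun p : (Fin k → ℝ) × (Fin d → ℝ) => c p.1 p.2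
  bounded : ∃ h : (Fin k → ℝ) × (Fin d → ℝ) → ℝ, Continuous h ∧
    ∀ s, 0 ≤ s → ∀ z, |c s z| ≤ h (s, z)
  hom : IsSuperHomogeneous δ c
  add : IsSuperAdditive c ∨ IsSubAdditive c

/-- The cost `c(s, (0, y⁽²⁾ - v⁽²⁾)) + sup_{s' ∈ φ s} f(s', y)` of moving from `v` to `y` when the
market data are `s` and the next cost is `f`; the argument is `((s, v), y)`. -/
def stepCost {d k : ℕ} [NeZero d] (c : (Fin k → ℝ) → (Fin d → ℝ) → ℝ)
    (φ : (Fin k → ℝ) → Set (Fin k → ℝ)) (f : (Fin k → ℝ) → (Fin d → ℝ) → ℝ)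
    (p : ((Fin k → ℝ) × (Fin d → ℝ)) × (Fin d → ℝ)) : EReal :=
  (c p.1.1 (risky (p.2 - p.1.2)) : EReal) + ⨆ s ∈ φ p.1.1, (f s p.2 : EReal)

/-- The minimal cost of one step from `(s, v)`. -/
def stepValue {d k : ℕ} [NeZero d] (c : (Fin k → ℝ) → (Fin d → ℝ) → ℝ)
    (φ : (Fin k → ℝ) → Set (Fin k → ℝ)) (f : (Fin k → ℝ) → (Fin d → ℝ) → ℝ)
    (q : (Fin k → ℝ) × (Fin d → ℝ)) : EReal :=
  ⨅ y, stepCost c φ f (q, y)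

/-- The market data in `K` for which the zero claim admits no immediate profit in the strong
sense, `f` being its next cost. -/
def noArbitrageSet {d k : ℕ} [NeZero d] (K : Set (Fin k → ℝ))
    (c : (Fin k → ℝ) → (Fin d → ℝ) → ℝ)
    (φ : (Fin k → ℝ) → Set (Fin k → ℝ)) (f : (Fin k → ℝ) → (Fin d → ℝ) → ℝ) :
    Set (Fin k → ℝ) :=
  {s | s ∈ K ∧ (φ s).Nonempty ∧ (∀ z, 0 ≤ stepCost c φ f ((s, 0), z)) ∧
    ∀ z, risky z ≠ 0 → 0 < stepCost c φ f ((s, 0), z)}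

/-- The properties of the cost functions `f₀` of the zero claim and `f` of a nonnegative claim that
are propagated by the dynamic programming recursion. -/
structure IsValuePair {d k : ℕ} [NeZero d] (δ : ℝ≥0∞ ≃o ℝ≥0∞) (K : Set (Fin k → ℝ))
    (f₀ f : (Fin k → ℝ) → (Fin d → ℝ) → ℝ) : Prop where
  lsc_zero : LowerSemicontinuous fun p : (Fin k → ℝ) × (Fin d → ℝ) => f₀ p.1 p.2
  lsc : LowerSemicontinuous fun p : (Fin k → ℝ) × (Fin d → ℝ) => f p.1 p.2
  risky_zero : ∀ s v, f₀ s (risky v) = f₀ s v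
  risky : ∀ s v, f s (risky v) = f s v
  le : ∀ s ∈ K, ∀ v, f₀ s v ≤ f s v
  hom : ∀ a : ℝ, 1 ≤ a → ∀ s ∈ K, ∀ v, (δ (ENNReal.ofReal a)).toReal * f₀ s v ≤ f₀ s (a • v)
  bounded : ∃ H : (Fin k → ℝ) × (Fin d → ℝ) → ℝ, Continuous H ∧
    ∀ s ∈ K, ∀ v, f s v ≤ H (s, v)

section step

variable {d k : ℕ} [NeZero d] {δ : ℝ≥0∞ ≃o ℝ≥0∞} {c f₀ f : (Fin k → ℝ) → (Fin d → ℝ) → ℝ}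
  {φ : (Fin k → ℝ) → Set (Fin k → ℝ)} {K K' : Set (Fin k → ℝ)}

theorem IsValuePair.left (h : IsValuePair δ K f₀ f) : IsValuePair δ K f₀ f₀ where
  lsc_zero := h.lsc_zero
  lsc := h.lsc_zero
  risky_zero := h.risky_zero
  risky := h.risky_zero
  le _ _ _ := le_rfl
  hom := h.hom
  bounded := by
    obtain ⟨H, hH, hb⟩ := h.bounded
    exact ⟨H, hH, fun s hs v => (h.le s hs v).trans (hb s hs v)⟩

theorem coe_lt_stepCost_iff {b : ℝ} {s : Fin k → ℝ} {v y : Fin d → ℝ} :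
    (b : EReal) < stepCost c φ f ((s, v), y) ↔
      ∃ s' ∈ φ s, b < c s (risky (y - v)) + f s' y := by
  have h1 : (b : EReal) < stepCost c φ f ((s, v), y) ↔
      ((b - c s (risky (y - v)) : ℝ) : EReal) < ⨆ s' ∈ φ s, (f s' y : EReal) := by
    rw [stepCost, EReal.coe_sub, add_comm]
    exact (EReal.sub_lt_iff (Or.inl (EReal.coe_ne_bot _)) (Or.inl (EReal.coe_ne_top _))).symm
  rw [h1]
  simp only [lt_iSup_iff, EReal.coe_lt_coe_iff, exists_prop, sub_lt_iff_lt_add']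

theorem stepCost_le_coe_iff {b : ℝ} {s : Fin k → ℝ} {v y : Fin d → ℝ} :
    stepCost c φ f ((s, v), y) ≤ b ↔ ∀ s' ∈ φ s, c s (risky (y - v)) + f s' y ≤ b := by
  rw [← not_lt, coe_lt_stepCost_iff]
  push Not
  rfl

theorem lowerSemicontinuous_stepCost (hc : IsCostFunction δ c) (hφ : LowerHemicontinuous φ)
    (hf : LowerSemicontinuous fun p : (Fin k → ℝ) × (Fin d → ℝ) => f p.1 p.2) :
    LowerSemicontinuous (stepCost c φ f) := by
  have h1 : LowerSemicontinuous fun p : ((Fin k → ℝ) × (Fin d → ℝ)) × (Fin d → ℝ) =>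
      (c p.1.1 (risky (p.2 - p.1.2)) : EReal) := by
    have hcont : Continuous fun p : ((Fin k → ℝ) × (Fin d → ℝ)) × (Fin d → ℝ) =>
        (p.1.1, risky (p.2 - p.1.2)) :=
      continuous_fst.fst.prodMk (continuous_risky.comp (continuous_snd.sub continuous_fst.snd))
    have h3 : LowerSemicontinuous fun p : ((Fin k → ℝ) × (Fin d → ℝ)) × (Fin d → ℝ) =>
        c p.1.1 (risky (p.2 - p.1.2)) := hc.lsc.comp hcont
    exact continuous_coe_real_ereal.comp_lowerSemicontinuous h3 EReal.coe_strictMono.monotone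
  have h2 : LowerSemicontinuous fun p : ((Fin k → ℝ) × (Fin d → ℝ)) × (Fin d → ℝ) =>
      ⨆ s ∈ φ p.1.1, (f s p.2 : EReal) := by
    have hcont : Continuous fun p : ((Fin k → ℝ) × (Fin d → ℝ)) × (Fin d → ℝ) =>
        (p.1.1, p.2) := continuous_fst.fst.prodMk continuous_snd
    exact (hφ.lowerSemicontinuous_iSup hf).comp hcont
  -- Addition on `EReal` is continuous here because the first summand is finite.
  have h4 : ∀ p : ((Fin k → ℝ) × (Fin d → ℝ)) × (Fin d → ℝ),
      ContinuousAt (fun x : EReal × EReal => x.1 + x.2)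
        ((c p.1.1 (risky (p.2 - p.1.2)) : EReal), ⨆ s ∈ φ p.1.1, (f s p.2 : EReal)) := fun p =>
    EReal.continuousAt_add (Or.inl (EReal.coe_ne_top _)) (Or.inl (EReal.coe_ne_bot _))
  exact LowerSemicontinuous.add' h1 h2 h4

theorem stepCost_risky_right (hf : ∀ s v, f s (risky v) = f s v)
    (q : (Fin k → ℝ) × (Fin d → ℝ)) (y : Fin d → ℝ) :
    stepCost c φ f (q, risky y) = stepCost c φ f (q, y) := by
  simp only [stepCost, risky_sub, risky_risky, hf]

theorem stepValue_risky (s : Fin k → ℝ) (v : Fin d → ℝ) :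
    stepValue c φ f (s, risky v) = stepValue c φ f (s, v) := by
  simp only [stepValue, stepCost, risky_sub, risky_risky]

theorem le_stepValue (hf : ∀ s v, f s (risky v) = f s v) {q : (Fin k → ℝ) × (Fin d → ℝ)}
    {b : EReal} (h : ∀ y : Fin d → ℝ, y 0 = 0 → b ≤ stepCost c φ f (q, y)) :
    b ≤ stepValue c φ f q :=
  le_iInf fun y => (h (risky y) (risky_apply_zero y)).trans_eq (stepCost_risky_right hf q y)

/-- The cost of one step from `(s, v)` is bounded below by the one from `(s, 0)` for the zero
claim, up to a continuous function of `(s, v)`. -/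
theorem exists_stepCost_le_add (hc : IsCostFunction δ c) (hK : ∀ s ∈ K, 0 ≤ s)
    (hφK : ∀ s ∈ K, φ s ⊆ K') :
    ∃ L : (Fin k → ℝ) × (Fin d → ℝ) → ℝ, Continuous L ∧
      ∀ f₀ f : (Fin k → ℝ) → (Fin d → ℝ) → ℝ, (∀ s ∈ K', ∀ v, f₀ s v ≤ f s v) →
      ∀ s ∈ K, ∀ (v y : Fin d → ℝ) (b : ℝ), stepCost c φ f ((s, v), y) ≤ b →
        stepCost c φ f₀ ((s, 0), y) ≤ ((b + L (s, v) : ℝ) : EReal) := by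
  obtain ⟨h, hcont, hb⟩ := hc.bounded
  -- Super-additivity needs a bound on the cost of `-risky v`, sub-additivity one on that of `risky
  -- v`; the sum covers both. This bound does not depend on `f₀` or `f`.
  refine ⟨fun q => |h (q.1, risky q.2)| + |h (q.1, -risky q.2)|, ?_,
    fun f₀ f hle s hs v y b hsb => ?_⟩
  · have := continuous_risky (d := d)
    fun_prop
  rw [stepCost_le_coe_iff] at hsb ⊢
  intro s' hs'
  have h1 := hsb s' hs'
  have h2 := hle s' (hφK s hs hs') y
  have h3 : c s (risky (y - 0)) ≤
      c s (risky (y - v)) + (|h (s, risky v)| + |h (s, -risky v)|) := by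
    have h4 := (abs_le.1 ((hb s (hK s hs) (risky v)).trans (le_abs_self _))).2
    have h5 := (abs_le.1 ((hb s (hK s hs) (-risky v)).trans (le_abs_self _))).1
    have h6 := abs_nonneg (h (s, risky v))
    have h7 := abs_nonneg (h (s, -risky v))
    rw [sub_zero, risky_sub]
    rcases hc.add with hadd | hadd
    · have := hadd s (hK s hs) (risky y) (-risky v)
      rw [← sub_eq_add_neg] at this
      linarith
    · have := hadd s (hK s hs) (risky y - risky v) (risky v)
      rw [sub_add_cancel] at this
      linarith
  simp only
  linarith

/-- A real `b` strictly below the step cost is beaten at a single `s'`, where both summands scale.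
This avoids multiplication in `EReal`. -/
theorem mul_le_stepCost_smul (hc : IsCostFunction δ c) (hK : ∀ s ∈ K, 0 ≤ s)
    (hφK : ∀ s ∈ K, φ s ⊆ K') (hf : IsValuePair δ K' f₀ f) {s : Fin k → ℝ} (hs : s ∈ K)
    {v y : Fin d → ℝ} {a b : ℝ} (ha : 1 ≤ a) (hb : (b : EReal) < stepCost c φ f₀ ((s, v), y)) :
    (((δ (ENNReal.ofReal a)).toReal * b : ℝ) : EReal) ≤ stepCost c φ f₀ ((s, a • v), a • y) := by
  obtain ⟨s', hs', h⟩ := coe_lt_stepCost_iff.1 hb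
  have h1 := hc.hom a ha s (hK s hs) (risky (y - v))
  have h2 := hf.hom a ha s' (hφK s hs hs') y
  refine le_of_forall_lt fun x hx => ?_
  refine hx.trans_le (le_trans ?_ (add_le_add le_rfl
    (le_iSup₂ (f := fun s (_ : s ∈ φ _) => (f₀ s (a • y) : EReal)) s' hs')))
  rw [← EReal.coe_add, EReal.coe_le_coe_iff]
  simp only
  rw [← smul_sub, risky_smul]
  have h4 := mul_le_mul_of_nonneg_left h.le
    (ENNReal.toReal_nonneg (a := δ (ENNReal.ofReal a)))
  linarith

/-- An order isomorphism of `[0, ∞]` takes the value `∞` only at `∞`, so it is finite and unbounded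
on the reals. -/
theorem exists_forall_le_toReal_orderIso (δ : ℝ≥0∞ ≃o ℝ≥0∞) (M : ℝ) :
    ∃ r : ℝ, ∀ a, r ≤ a → M ≤ (δ (ENNReal.ofReal a)).toReal := by
  have hne : δ.symm (ENNReal.ofReal M) ≠ ∞ := fun h => by
    have := congrArg δ h
    rw [OrderIso.apply_symm_apply, OrderIso.map_top] at this
    exact ENNReal.ofReal_ne_top this
  refine ⟨(δ.symm (ENNReal.ofReal M)).toReal, fun a ha => ?_⟩
  have h1 : ENNReal.ofReal M ≤ δ (ENNReal.ofReal a) := by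
    rw [← OrderIso.symm_apply_le, ← ENNReal.ofReal_toReal hne]
    exact ENNReal.ofReal_le_ofReal ha
  refine (ENNReal.ofReal_le_iff_le_toReal fun h => ?_).1 h1
  have := congrArg δ.symm h
  rw [OrderIso.symm_apply_apply, OrderIso.map_top] at this
  exact ENNReal.ofReal_ne_top this

/-- Near a point of the no-arbitrage set the cost of one step is coercive, uniformly. -/
theorem eventually_norm_le_of_stepCost_le (hc : IsCostFunction δ c)
    (hφ : LowerHemicontinuous φ) (hK : ∀ s ∈ K, 0 ≤ s) (hφK : ∀ s ∈ K, φ s ⊆ K')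
    (hf : IsValuePair δ K' f₀ f) {s₀ : Fin k → ℝ} (hs₀ : s₀ ∈ noArbitrageSet K c φ f₀)
    (v₀ : Fin d → ℝ) (M : ℝ) :
    ∃ r : ℝ, ∀ᶠ q in 𝓝 (s₀, v₀), q.1 ∈ K → ∀ y : Fin d → ℝ, y 0 = 0 →
      stepCost c φ f (q, y) ≤ M → ‖y‖ ≤ r := by
  obtain ⟨L, hL, hLle⟩ := exists_stepCost_le_add (d := d) hc hK hφK
  have hlsc := lowerSemicontinuous_stepCost hc hφ hf.lsc_zero
  have hsph : IsCompact (Metric.sphere (0 : Fin d → ℝ) 1 ∩ {y | y 0 = 0}) :=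
    (isCompact_sphere _ _).inter_right (isClosed_eq (continuous_apply 0) continuous_const)
  have hlsc' : LowerSemicontinuous fun p : (Fin k → ℝ) × (Fin d → ℝ) =>
      stepCost c φ f₀ ((p.1, 0), p.2) :=
    hlsc.comp (g := fun p : (Fin k → ℝ) × (Fin d → ℝ) => ((p.1, (0 : Fin d → ℝ)), p.2))
      (by fun_prop)
  -- Strict positivity at each point of the compact sphere of risky positions gives a positive
  -- minimum.
  have hpos : ((0 : ℝ) : EReal) < ⨅ y ∈ Metric.sphere (0 : Fin d → ℝ) 1 ∩ {y | y 0 = 0},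
      stepCost c φ f₀ ((s₀, 0), y) := by
    rw [← not_le, hlsc'.iInf_le_iff_of_isCompact hsph]
    rintro ⟨y, ⟨hy1, hy0⟩, hy⟩
    refine absurd hy (not_le.2 (hs₀.2.2.2 y ?_))
    rw [risky_eq_self hy0]
    rintro rfl
    simp at hy1
  obtain ⟨ε, hε0, hε⟩ := EReal.lt_iff_exists_real_btwn.1 hpos
  rw [EReal.coe_lt_coe_iff] at hε0
  -- Passing to the zero claim from position `0` raises the level `M` to `M + L q`, which is below
  -- `M + L (s₀, v₀) + 1` nearby; the constant `2` leaves a strict gap.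
  obtain ⟨r, hr⟩ := exists_forall_le_toReal_orderIso δ ((M + L (s₀, v₀) + 2) / ε)
  -- The maximum with `1` is there because super-homogeneity applies only to factors at least `1`.
  refine ⟨max r 1, ?_⟩
  have h1 : ∀ᶠ q in 𝓝 (s₀, v₀), (ε : EReal) <
      ⨅ y ∈ Metric.sphere (0 : Fin d → ℝ) 1 ∩ {y | y 0 = 0},
      stepCost c φ f₀ ((q.1, 0), y) :=
    (continuous_fst.tendsto (s₀, v₀)).eventually (hlsc'.iInf_of_isCompact hsph s₀ ε hε)
  have h2 : ∀ᶠ q in 𝓝 (s₀, v₀), L q < L (s₀, v₀) + 1 :=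
    hL.continuousAt.eventually_lt_const (by linarith)
  filter_upwards [h1, h2] with q hq1 hq2 hqK y hy0 hyM
  by_contra! hlt
  have hy1 : 1 ≤ ‖y‖ := (le_max_right r 1).trans hlt.le
  have hyr : r ≤ ‖y‖ := (le_max_left r 1).trans hlt.le
  have hy : ‖y‖ ≠ 0 := by positivity
  have hmem : ‖y‖⁻¹ • y ∈ Metric.sphere (0 : Fin d → ℝ) 1 ∩ {y | y 0 = 0} := by
    refine ⟨?_, by simp [hy0]⟩
    rw [mem_sphere_zero_iff_norm, norm_smul, norm_inv, norm_norm, inv_mul_cancel₀ hy]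
  have h3 := mul_le_stepCost_smul hc hK hφK hf hqK hy1 (hq1.trans_le (iInf₂_le _ hmem))
  rw [smul_zero, smul_inv_smul₀ hy] at h3
  have h4 := hLle f₀ f hf.le q.1 hqK q.2 y M hyM
  have h5 := EReal.coe_le_coe_iff.1 (h3.trans h4)
  have h6 := mul_le_mul_of_nonneg_right (hr _ hyr) hε0.le
  rw [div_mul_cancel₀ _ hε0.ne'] at h6
  linarith

theorem isCompact_closedBall_inter_cash (r : ℝ) :
    IsCompact (Metric.closedBall (0 : Fin d → ℝ) r ∩ {y | y 0 = 0}) :=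
  (isCompact_closedBall _ _).inter_right (isClosed_eq (continuous_apply 0) continuous_const)

/-- By coercivity, positions costing less than a level `b'` lie in one ball for all nearby `q`, so
the infimum may be compared with one over a compact set. -/
theorem lowerSemicontinuousWithinAt_stepValue (hc : IsCostFunction δ c)
    (hφ : LowerHemicontinuous φ) (hK : ∀ s ∈ K, 0 ≤ s) (hφK : ∀ s ∈ K, φ s ⊆ K')
    (hf : IsValuePair δ K' f₀ f) {q₀ : (Fin k → ℝ) × (Fin d → ℝ)}
    (hq₀ : q₀ ∈ noArbitrageSet K c φ f₀ ×ˢ Set.univ) :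
    LowerSemicontinuousWithinAt (stepValue c φ f) (noArbitrageSet K c φ f₀ ×ˢ Set.univ) q₀ := by
  intro b hb
  obtain ⟨b', hb1, hb2⟩ := EReal.lt_iff_exists_real_btwn.1 hb
  obtain ⟨r, hr⟩ := eventually_norm_le_of_stepCost_le hc hφ hK hφK hf hq₀.1 q₀.2 b'
  have hJ : (b' : EReal) < ⨅ y ∈ Metric.closedBall (0 : Fin d → ℝ) r ∩ {y | y 0 = 0},
      stepCost c φ f (q₀, y) :=
    hb2.trans_le (le_iInf₂ fun y _ => iInf_le _ y)
  have h1 := (lowerSemicontinuous_stepCost hc hφ hf.lsc).iInf_of_isCompact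
    (isCompact_closedBall_inter_cash (d := d) r) q₀ b' hJ
  filter_upwards [nhdsWithin_le_nhds hr, nhdsWithin_le_nhds h1, self_mem_nhdsWithin]
    with q hq1 hq2 hq3
  refine hb1.trans_le (le_stepValue hf.risky fun y hy => ?_)
  by_contra! hlt
  have hyr := hq1 hq3.1.1 y hy hlt.le
  exact absurd hlt (not_lt.2 (hq2.le.trans (iInf₂_le y ⟨by simpa using hyr, hy⟩)))

theorem exists_stepCost_le_stepValue (hc : IsCostFunction δ c)
    (hφ : LowerHemicontinuous φ) (hK : ∀ s ∈ K, 0 ≤ s) (hφK : ∀ s ∈ K, φ s ⊆ K')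
    (hf : IsValuePair δ K' f₀ f) {s : Fin k → ℝ} (hs : s ∈ noArbitrageSet K c φ f₀)
    {v : Fin d → ℝ} {m : ℝ} (hm : stepValue c φ f (s, v) = m) :
    ∃ y : Fin d → ℝ, y 0 = 0 ∧ stepCost c φ f ((s, v), y) ≤ m := by
  obtain ⟨r, hr⟩ := eventually_norm_le_of_stepCost_le hc hφ hK hφK hf hs v (m + 1)
  have hr' := hr.self_of_nhds hs.1
  have hJ : ⨅ y ∈ Metric.closedBall (0 : Fin d → ℝ) r ∩ {y | y 0 = 0},
      stepCost c φ f ((s, v), y) ≤ (m : EReal) := by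
    by_contra! hlt
    obtain ⟨b, hb1, hb2⟩ := EReal.lt_iff_exists_real_btwn.1 hlt
    -- A position cheaper than `min b (m + 1)` would lie in the ball, by the bound `m + 1`, yet cost
    -- more than `b` there.
    have hm1 : (m : EReal) < ((min b (m + 1) : ℝ) : EReal) := by
      rw [EReal.coe_lt_coe_iff] at hb1 ⊢
      exact lt_min hb1 (by linarith)
    refine absurd hm.le (not_le.2 (hm1.trans_le (le_stepValue hf.risky fun y hy => ?_)))
    by_contra! hlt'
    have hyr := hr' y hy (hlt'.le.trans (EReal.coe_le_coe_iff.2 (min_le_right _ _)))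
    have h1 := hb2.trans_le (iInf₂_le y ⟨by simpa using hyr, hy⟩)
    exact absurd (h1.trans hlt') (not_lt.2 (EReal.coe_le_coe_iff.2 (min_le_left _ _)))
  obtain ⟨y, hy, hle⟩ := ((lowerSemicontinuous_stepCost hc hφ hf.lsc).iInf_le_iff_of_isCompact
    (isCompact_closedBall_inter_cash (d := d) r) _ _).1 hJ
  exact ⟨y, hy.2, hle⟩

theorem stepValue_mono (hφK : ∀ s ∈ K, φ s ⊆ K') (hle : ∀ s ∈ K', ∀ v, f₀ s v ≤ f s v)
    {q : (Fin k → ℝ) × (Fin d → ℝ)} (hq : q.1 ∈ K) : stepValue c φ f₀ q ≤ stepValue c φ f q :=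
  iInf_mono fun y => add_le_add le_rfl
    (iSup₂_mono fun s hs => EReal.coe_le_coe_iff.2 (hle s (hφK _ hq hs) y))

/-- The position `y = 0` is a competitor, and its next cost is bounded over the ball of radius `R
s`. -/
theorem exists_stepValue_le (hc : IsCostFunction δ c) (hK : ∀ s ∈ K, 0 ≤ s)
    (hφK : ∀ s ∈ K, φ s ⊆ K') {R : (Fin k → ℝ) → ℝ} (hR : Continuous R)
    (hφR : ∀ s ∈ K, φ s ⊆ Metric.closedBall 0 (R s)) (hf : IsValuePair δ K' f₀ f) :
    ∃ H : (Fin k → ℝ) × (Fin d → ℝ) → ℝ, Continuous H ∧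
      ∀ q : (Fin k → ℝ) × (Fin d → ℝ), q.1 ∈ K → stepValue c φ f q ≤ (H q : EReal) := by
  obtain ⟨h, hcont, hb⟩ := hc.bounded
  obtain ⟨H, hH, hHf⟩ := hf.bounded
  obtain ⟨B, hB, hBle⟩ := exists_continuous_bound_on_closedBall hR
    (hH.comp (Continuous.prodMk_left (0 : Fin d → ℝ)))
  refine ⟨fun q => h (q.1, risky (0 - q.2)) + B q.1, ?_, fun q hq => ?_⟩
  · have := continuous_risky (d := d)
    fun_prop
  · refine (iInf_le _ 0).trans (stepCost_le_coe_iff.2 fun s' hs' => ?_)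
    exact add_le_add ((le_abs_self _).trans (hb q.1 (hK _ hq) _))
      ((hHf s' (hφK _ hq hs') 0).trans (hBle q.1 s' (hφR _ hq hs')))

/-- The zero claim costs at least `0` from position `0`; moving to `v` and to the larger `f` lowers
this bound by at most `L`. -/
theorem exists_le_stepValue (hc : IsCostFunction δ c) (hK : ∀ s ∈ K, 0 ≤ s)
    (hφK : ∀ s ∈ K, φ s ⊆ K') :
    ∃ L : (Fin k → ℝ) × (Fin d → ℝ) → ℝ, Continuous L ∧
      ∀ f₀ f : (Fin k → ℝ) → (Fin d → ℝ) → ℝ, (∀ s ∈ K', ∀ v, f₀ s v ≤ f s v) →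
      ∀ q ∈ noArbitrageSet K c φ f₀ ×ˢ (Set.univ : Set (Fin d → ℝ)),
        (L q : EReal) ≤ stepValue c φ f q := by
  obtain ⟨L, hL, hLle⟩ := exists_stepCost_le_add (d := d) hc hK hφK
  refine ⟨fun q => -L q, hL.neg, fun f₀ f hle q hq => le_iInf fun y => ?_⟩
  by_contra! hlt
  obtain ⟨b, hb1, hb2⟩ := EReal.lt_iff_exists_real_btwn.1 hlt
  have h1 := (hq.1.2.2.1 y).trans (hLle f₀ f hle q.1 hq.1.1 q.2 y b hb1.le)
  have h2 : 0 ≤ b + L q := EReal.coe_nonneg.1 h1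
  rw [EReal.coe_lt_coe_iff] at hb2
  linarith

theorem mul_le_stepValue_smul (hc : IsCostFunction δ c) (hK : ∀ s ∈ K, 0 ≤ s)
    (hφK : ∀ s ∈ K, φ s ⊆ K') (hf : IsValuePair δ K' f₀ f) {s : Fin k → ℝ} (hs : s ∈ K)
    {v : Fin d → ℝ} {a b : ℝ} (ha : 1 ≤ a) (hb : (b : EReal) < stepValue c φ f₀ (s, v)) :
    (((δ (ENNReal.ofReal a)).toReal * b : ℝ) : EReal) ≤ stepValue c φ f₀ (s, a • v) := by
  refine le_iInf fun y => ?_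
  have ha0 : a ≠ 0 := by positivity
  have := mul_le_stepCost_smul hc hK hφK hf hs (y := a⁻¹ • y) ha (hb.trans_le (iInf_le _ _))
  rwa [smul_inv_smul₀ ha0] at this

/-- One step of the backward recursion, with values extended from the no-arbitrage set to lower
semicontinuous functions on the whole space. -/
theorem exists_isValuePair_step (hc : IsCostFunction δ c)
    (hφ : LowerHemicontinuous φ) (hK : ∀ s ∈ K, 0 ≤ s) (hφK : ∀ s ∈ K, φ s ⊆ K')
    {R : (Fin k → ℝ) → ℝ} (hR : Continuous R) (hφR : ∀ s ∈ K, φ s ⊆ Metric.closedBall 0 (R s))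
    (hf : IsValuePair δ K' f₀ f) (hcl : K ⊆ closure (noArbitrageSet K c φ f₀)) :
    ∃ g₀ g : (Fin k → ℝ) → (Fin d → ℝ) → ℝ, IsValuePair δ K g₀ g ∧
      (∀ s ∈ noArbitrageSet K c φ f₀, ∀ v, (g₀ s v : EReal) = stepValue c φ f₀ (s, v)) ∧
      ∀ s ∈ noArbitrageSet K c φ f₀, ∀ v, (g s v : EReal) = stepValue c φ f (s, v) := by
  obtain ⟨H, hH, hHle⟩ := exists_stepValue_le hc hK hφK hR hφR hf
  obtain ⟨L, hL, hLle⟩ := exists_le_stepValue (d := d) hc hK hφK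
  set A : Set ((Fin k → ℝ) × (Fin d → ℝ)) := noArbitrageSet K c φ f₀ ×ˢ Set.univ with hA
  have hL0 : ∀ q ∈ A, (L q : EReal) ≤ stepValue c φ f₀ q := hLle f₀ f₀ fun _ _ _ => le_rfl
  have hL1 : ∀ q ∈ A, (L q : EReal) ≤ stepValue c φ f q := hLle f₀ f hf.le
  have hH1 : ∀ q ∈ A, stepValue c φ f q ≤ (H q : EReal) := fun q hq => hHle q hq.1.1
  have hH0 : ∀ q ∈ A, stepValue c φ f₀ q ≤ (H q : EReal) := fun q hq =>
    (stepValue_mono hφK hf.le hq.1.1).trans (hH1 q hq)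
  have hclA : ∀ s ∈ K, ∀ v : Fin d → ℝ, (s, v) ∈ closure A := fun s hs v => by
    rw [hA, closure_prod_eq]
    exact ⟨hcl hs, subset_closure trivial⟩
  have hcr : Continuous fun p : (Fin k → ℝ) × (Fin d → ℝ) => (p.1, risky p.2) :=
    continuous_fst.prodMk (continuous_risky.comp continuous_snd)
  -- Evaluating at `risky v` makes independence of the cash component hold off `A` too.
  refine ⟨fun s v => lscExtension A (stepValue c φ f₀) H (s, risky v),
    fun s v => lscExtension A (stepValue c φ f) H (s, risky v), ⟨?_, ?_, ?_, ?_, ?_, ?_, ?_⟩,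
    ?_, ?_⟩
  · exact (lowerSemicontinuous_lscExtension hL hH hL0).comp hcr
  · exact (lowerSemicontinuous_lscExtension hL hH hL1).comp hcr
  · intro s v
    simp only [risky_risky]
  · intro s v
    simp only [risky_risky]
  · intro s hs v
    rw [← EReal.coe_le_coe_iff, coe_lscExtension_of_mem_closure hL hH hL0 hH0 (hclA s hs _),
      coe_lscExtension_of_mem_closure hL hH hL1 hH1 (hclA s hs _)]
    refine liminf_le_liminf ?_
    filter_upwards [self_mem_nhdsWithin] with q hq using stepValue_mono hφK hf.le hq.1.1
  · intro a ha s hs v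
    -- Scaling the position preserves `A`, a product with the whole space, so homogeneity on `A`
    -- passes to lower limits; the strict bound `b` is then raised to the value itself.
    have key : ∀ b : ℝ, b < lscExtension A (stepValue c φ f₀) H (s, risky v) →
        (δ (ENNReal.ofReal a)).toReal * b ≤
          lscExtension A (stepValue c φ f₀) H (s, risky (a • v)) := by
      intro b hb
      rw [← EReal.coe_lt_coe_iff,
        coe_lscExtension_of_mem_closure hL hH hL0 hH0 (hclA s hs _)] at hb
      rw [← EReal.coe_le_coe_iff,
        coe_lscExtension_of_mem_closure hL hH hL0 hH0 (hclA s hs _)]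
      refine le_liminf_of_le (by isBoundedDefault) ?_
      have ha0 : a ≠ 0 := by positivity
      have ht : Tendsto (fun q : (Fin k → ℝ) × (Fin d → ℝ) => (q.1, a⁻¹ • q.2))
          (𝓝[A] (s, risky (a • v))) (𝓝[A] (s, risky v)) := by
        refine tendsto_nhdsWithin_of_tendsto_nhds_of_eventually_within _ ?_ ?_
        · have : Continuous fun q : (Fin k → ℝ) × (Fin d → ℝ) => (q.1, a⁻¹ • q.2) := by fun_prop
          have h := this.tendsto (s, risky (a • v))
          simp only [risky_smul, inv_smul_smul₀ ha0] at h ⊢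
          exact h.mono_left nhdsWithin_le_nhds
        · filter_upwards [self_mem_nhdsWithin] with q hq using ⟨hq.1, trivial⟩
      filter_upwards [ht.eventually (eventually_lt_of_lt_liminf hb), self_mem_nhdsWithin]
        with q hq hqA
      have := mul_le_stepValue_smul hc hK hφK hf hqA.1.1 ha hq
      rwa [smul_inv_smul₀ ha0] at this
    set x := lscExtension A (stepValue c φ f₀) H (s, risky v)
    have hlim : Tendsto (fun b : ℝ => (δ (ENNReal.ofReal a)).toReal * b) (𝓝[<] x)
        (𝓝 ((δ (ENNReal.ofReal a)).toReal * x)) :=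
      ((continuous_const.mul continuous_id).tendsto x).mono_left nhdsWithin_le_nhds
    refine le_of_tendsto hlim ?_
    filter_upwards [self_mem_nhdsWithin] with b hb using key b hb
  · exact ⟨fun q => H (q.1, risky q.2), hH.comp hcr, fun s _ v => lscExtension_le hL hL1 _⟩
  · intro s hs v
    have hq : (s, risky v) ∈ A := ⟨hs, trivial⟩
    rw [coe_lscExtension_of_mem hL hH hL0 hH0 hq
      (lowerSemicontinuousWithinAt_stepValue hc hφ hK hφK hf.left hq), stepValue_risky]
  · intro s hs v
    have hq : (s, risky v) ∈ A := ⟨hs, trivial⟩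
    rw [coe_lscExtension_of_mem hL hH hL1 hH1 hq
      (lowerSemicontinuousWithinAt_stepValue hc hφ hK hφK hf hq), stepValue_risky]

end step


/-! ### Conditional essential suprema and conditional supports -/

section condSupport

variable {Ω : Type*} {m mΩ : MeasurableSpace Ω} {P : Measure Ω}

theorem ae_le_condEssSup_singleton [IsFiniteMeasure P] (hm : m ≤ mΩ) (X : Ω → EReal) :
    X ≤ᵐ[P] condEssSup m P {X} :=
  (isCondEssSup_condEssSup hm P {X}).2.1 X rfl

theorem condEssSup_singleton_ae_le [IsFiniteMeasure P] (hm : m ≤ mΩ) {X Z : Ω → EReal}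
    (hZ : Measurable[m] Z) (h : X ≤ᵐ[P] Z) : condEssSup m P {X} ≤ᵐ[P] Z :=
  (isCondEssSup_condEssSup hm P {X}).2.2 Z hZ fun Y hY => by
    rw [Set.mem_singleton_iff.1 hY]; exact h

theorem measurableSet_setOf_comp_le {E G : Type*} [TopologicalSpace E] [MeasurableSpace E]
    [BorelSpace E] [SecondCountableTopology E] [TopologicalSpace G] [MeasurableSpace G]
    [BorelSpace G] [SecondCountableTopology G] {f : E → G → ℝ}
    (hf : LowerSemicontinuous fun p : E × G => f p.1 p.2) {Y : Ω → G} (hY : Measurable[m] Y)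
    {Z : Ω → EReal} (hZ : Measurable[m] Z) :
    MeasurableSet[m.prod inferInstance] {p : Ω × E | (f p.2 (Y p.1) : EReal) ≤ Z p.1} := by
  have hfm : Measurable fun p : E × G => f p.1 p.2 := hf.measurable
  have h1 : Measurable[m.prod inferInstance] fun p : Ω × E => (p.2, Y p.1) :=
    measurable_snd.prodMk (hY.comp measurable_fst)
  exact measurableSet_le (measurable_coe_real_ereal.comp (hfm.comp h1))
    (hZ.comp measurable_fst)

/-- A conditionally deterministic upper bound of a lower semicontinuous function of `X` is an upper
bound on the whole conditional support of `X`. -/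
theorem IsCondSupport.ae_iSup_le {E G : Type*} [TopologicalSpace E] [MeasurableSpace E]
    [BorelSpace E] [SecondCountableTopology E] [TopologicalSpace G] [MeasurableSpace G]
    [BorelSpace G] [SecondCountableTopology G] {X : Ω → E} {K : Ω → Set E}
    (hK : IsCondSupport m P X K) {f : E → G → ℝ}
    (hf : LowerSemicontinuous fun p : E × G => f p.1 p.2) {Y : Ω → G} (hY : Measurable[m] Y)
    {Z : Ω → EReal} (hZ : Measurable[m] Z) (h : ∀ᵐ ω ∂P, (f (X ω) (Y ω) : EReal) ≤ Z ω) :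
    ∀ᵐ ω ∂P, ⨆ s ∈ K ω, (f s (Y ω) : EReal) ≤ Z ω := by
  have hcl : ∀ ω, IsClosed {s | (f s (Y ω) : EReal) ≤ Z ω} := fun ω =>
    (continuous_coe_real_ereal.comp_lowerSemicontinuous
      (hf.comp (Continuous.prodMk_left (Y ω))) EReal.coe_strictMono.monotone).isClosed_preimage _
  filter_upwards [hK.2.2 (fun ω => {s | (f s (Y ω) : EReal) ≤ Z ω})
    ⟨hcl, measurableSet_setOf_comp_le hf hY hZ⟩ h] with ω hω
  exact iSup₂_le fun s hs => hω hs

/-- The conditional support lies in every closed set that contains `X` almost surely. -/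
theorem IsCondSupport.ae_subset {E : Type*} [TopologicalSpace E] [MeasurableSpace E]
    [BorelSpace E] {X : Ω → E} {K : Ω → Set E} (hK : IsCondSupport m P X K) {A : Set E}
    (hA : IsClosed A) (h : ∀ᵐ ω ∂P, X ω ∈ A) : ∀ᵐ ω ∂P, K ω ⊆ A := by
  have hsnd : Measurable[m.prod inferInstance] (Prod.snd : Ω × E → E) := measurable_snd
  exact hK.2.2 (fun _ => A) ⟨fun _ => hA, hsnd hA.measurableSet⟩ h

end condSupport

/-! ### Supports of laws -/

section support

variable {Ω E : Type*} {mΩ : MeasurableSpace Ω} {P : Measure Ω} [TopologicalSpace E]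
  [MeasurableSpace E] [BorelSpace E] {X : Ω → E}

omit [BorelSpace E] in
theorem ae_mem_support_map [SecondCountableTopology E] (hX : Measurable X) :
    ∀ᵐ ω ∂P, X ω ∈ (P.map X).support :=
  ae_of_ae_map hX.aemeasurable (Measure.support_mem_ae (μ := P.map X))

theorem support_map_subset (hX : Measurable X) {A : Set E} (hA : IsClosed A)
    (h : ∀ᵐ ω ∂P, X ω ∈ A) : (P.map X).support ⊆ A :=
  Measure.support_subset_of_isClosed hA
    ((ae_map_iff hX.aemeasurable hA.measurableSet).2 h)

end support

/-! ### Strategies -/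

section strategy

variable {Ω : Type*} {T d k : ℕ} [NeZero d] {S : ℕ → Ω → (Fin k → ℝ)}
  {C : ℕ → (Fin k → ℝ) → (Fin d → ℝ) → ℝ} {ξ : Ω → (Fin d → ℝ)}

theorem strategyCost_self (v : Ω → (Fin d → ℝ)) (W : ℕ → Ω → (Fin d → ℝ)) (ω : Ω) :
    strategyCost T S C ξ T v W ω = ξ ω 0 + C T (S T ω) (risky (W T ω - v ω)) := by
  simp [strategyCost]

theorem strategyCost_eq_add {t : ℕ} (ht : t < T) (v : Ω → (Fin d → ℝ))
    (W : ℕ → Ω → (Fin d → ℝ)) (ω : Ω) :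
    strategyCost T S C ξ t v W ω =
      C t (S t ω) (risky (W t ω - v ω)) + strategyCost T S C ξ (t + 1) (W t) W ω := by
  have h1 : Finset.Icc t T = insert t (Finset.Icc (t + 1) T) := by
    ext u; simp only [Finset.mem_insert, Finset.mem_Icc]; omega
  have h2 : t ∉ Finset.Icc (t + 1) T := by simp
  rw [strategyCost, strategyCost, h1, Finset.sum_insert h2, if_pos rfl, add_left_comm]
  congr 2
  refine Finset.sum_congr rfl fun u hu => ?_
  rw [Finset.mem_Icc] at hu
  rw [if_neg (show u ≠ t by omega)]
  by_cases h : u = t + 1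
  · subst h; simp
  · rw [if_neg h]

theorem strategyCost_congr {t : ℕ} {W W' : ℕ → Ω → (Fin d → ℝ)} (h : ∀ u, t ≤ u → W u = W' u)
    (v : Ω → (Fin d → ℝ)) (ω : Ω) :
    strategyCost T S C ξ t v W ω = strategyCost T S C ξ t v W' ω := by
  rw [strategyCost, strategyCost]
  congr 1
  refine Finset.sum_congr rfl fun u hu => ?_
  rw [Finset.mem_Icc] at hu
  rw [h u hu.1]
  by_cases hu' : u = t
  · rw [if_pos hu', if_pos hu']
  · rw [if_neg hu', if_neg hu', h (u - 1) (by omega)]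

end strategy

/-- `f (S_t) v` is the infimum hedging cost at time `t` from the position `v`, and it is
reached. -/
structure IsHedgingValue {Ω : Type*} {mΩ : MeasurableSpace Ω} (P : Measure Ω)
    (F : Filtration ℕ mΩ) (T : ℕ) {d k : ℕ} [NeZero d] (S : ℕ → Ω → (Fin k → ℝ))
    (C : ℕ → (Fin k → ℝ) → (Fin d → ℝ) → ℝ) (ξ : Ω → (Fin d → ℝ)) (t : ℕ)
    (f : (Fin k → ℝ) → (Fin d → ℝ) → ℝ) : Prop where
  le_cost : ∀ V : Ω → (Fin d → ℝ), Measurable[F t] V → ∀ W, IsStrategy F T ξ t W →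
    ∀ᵐ ω ∂P, (f (S t ω) (V ω) : EReal) ≤ condStrategyCost P F T S C ξ t V W ω
  exists_le : ∀ V : Ω → (Fin d → ℝ), Measurable[F t] V → ∃ W, IsStrategy F T ξ t W ∧
    ∀ᵐ ω ∂P, strategyCost T S C ξ t V W ω ≤ f (S t ω) (V ω)

section market

variable {Ω : Type*} {mΩ : MeasurableSpace Ω} {P : Measure Ω} [IsProbabilityMeasure P]
  {F : Filtration ℕ mΩ} {T : ℕ} {d k : ℕ} [NeZero d]
  {S : ℕ → Ω → (Fin k → ℝ)} {C : ℕ → (Fin k → ℝ) → (Fin d → ℝ) → ℝ} {ξ : Ω → (Fin d → ℝ)}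
  {φ : ℕ → (Fin k → ℝ) → Set (Fin k → ℝ)} {t : ℕ} {f : (Fin k → ℝ) → (Fin d → ℝ) → ℝ}

omit [NeZero d] in
theorem measurable_comp_of_lowerSemicontinuous
    (hf : LowerSemicontinuous fun p : (Fin k → ℝ) × (Fin d → ℝ) => f p.1 p.2)
    (hS : Measurable[F t] (S t)) {V : Ω → (Fin d → ℝ)} (hV : Measurable[F t] V) :
    Measurable[F t] fun ω => (f (S t ω) (V ω) : EReal) :=
  measurable_coe_real_ereal.comp (hf.measurable.comp (hS.prodMk hV))

theorem IsHedgingValue.exists_condStrategyCost_ae_eq (h : IsHedgingValue P F T S C ξ t f)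
    (hf : LowerSemicontinuous fun p : (Fin k → ℝ) × (Fin d → ℝ) => f p.1 p.2)
    (hS : Measurable[F t] (S t)) {V : Ω → (Fin d → ℝ)} (hV : Measurable[F t] V) :
    ∃ W, IsStrategy F T ξ t W ∧
      condStrategyCost P F T S C ξ t V W =ᵐ[P] fun ω => (f (S t ω) (V ω) : EReal) := by
  obtain ⟨W, hW, hle⟩ := h.exists_le V hV
  refine ⟨W, hW, ?_⟩
  have h1 : condStrategyCost P F T S C ξ t V W ≤ᵐ[P] fun ω => (f (S t ω) (V ω) : EReal) :=
    condEssSup_singleton_ae_le (F.le t) (measurable_comp_of_lowerSemicontinuous hf hS hV)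
      (hle.mono fun ω hω => EReal.coe_le_coe_iff.2 hω)
  filter_upwards [h1, h.le_cost V hV W hW] with ω h2 h3 using le_antisymm h2 h3

theorem IsHedgingValue.hedgingCost_ae_eq (h : IsHedgingValue P F T S C ξ t f)
    (hf : LowerSemicontinuous fun p : (Fin k → ℝ) × (Fin d → ℝ) => f p.1 p.2)
    (hS : Measurable[F t] (S t)) {V : Ω → (Fin d → ℝ)} (hV : Measurable[F t] V) :
    hedgingCost P F T S C ξ t V =ᵐ[P] fun ω => (f (S t ω) (V ω) : EReal) := by
  have hinf := isCondEssInf_condEssInf (F.le t) P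
    {X | ∃ W, IsStrategy F T ξ t W ∧ X = condStrategyCost P F T S C ξ t V W}
  obtain ⟨W, hW, hWeq⟩ := h.exists_condStrategyCost_ae_eq hf hS hV
  have h1 := hinf.2.1 _ ⟨W, hW, rfl⟩
  have h2 := hinf.2.2 _ (measurable_comp_of_lowerSemicontinuous hf hS hV) (by
    rintro _ ⟨W', hW', rfl⟩
    exact h.le_cost V hV W' hW')
  filter_upwards [h1, h2, hWeq] with ω h3 h4 h5
  exact le_antisymm (h3.trans_eq h5) h4

omit [NeZero d] in
theorem measurable_iSup_comp (hφ : LowerHemicontinuous (φ t))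
    (hf : LowerSemicontinuous fun p : (Fin k → ℝ) × (Fin d → ℝ) => f p.1 p.2)
    (hS : Measurable[F t] (S t)) {Y : Ω → (Fin d → ℝ)} (hY : Measurable[F t] Y) :
    Measurable[F t] fun ω => ⨆ s ∈ φ t (S t ω), (f s (Y ω) : EReal) :=
  (hφ.lowerSemicontinuous_iSup hf).measurable.comp (hS.prodMk hY)

theorem measurable_stepCost_comp {δ : ℝ≥0∞ ≃o ℝ≥0∞} (hc : IsCostFunction δ (C t))
    (hφ : LowerHemicontinuous (φ t))
    (hf : LowerSemicontinuous fun p : (Fin k → ℝ) × (Fin d → ℝ) => f p.1 p.2)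
    (hS : Measurable[F t] (S t)) {V Y : Ω → (Fin d → ℝ)} (hV : Measurable[F t] V)
    (hY : Measurable[F t] Y) :
    Measurable[F t] fun ω => stepCost (C t) (φ t) f ((S t ω, V ω), Y ω) :=
  (lowerSemicontinuous_stepCost hc hφ hf).measurable.comp ((hS.prodMk hV).prodMk hY)

omit [IsProbabilityMeasure P] in
/-- Trading to `Y` and hedging optimally afterwards costs at most `stepCost`. -/
theorem IsHedgingValue.exists_strategyCost_le (h : IsHedgingValue P F T S C ξ (t + 1) f)
    (ht : t < T) (hsupp : ∀ᵐ ω ∂P, S (t + 1) ω ∈ φ t (S t ω)) (V : Ω → (Fin d → ℝ))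
    {Y : Ω → (Fin d → ℝ)} (hY : Measurable[F t] Y) :
    ∃ W, IsStrategy F T ξ t W ∧ ∀ᵐ ω ∂P,
      (strategyCost T S C ξ t V W ω : EReal) ≤ stepCost (C t) (φ t) f ((S t ω, V ω), Y ω) := by
  obtain ⟨W, hW, hle⟩ := h.exists_le Y (hY.mono (F.mono t.le_succ) le_rfl)
  have hne : ∀ u, t + 1 ≤ u → Function.update W t Y u = W u := fun u hu =>
    Function.update_of_ne (by omega) _ _
  refine ⟨Function.update W t Y, ⟨fun u hu huT => ?_, (hne T ht).trans hW.2⟩, ?_⟩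
  · rcases hu.eq_or_lt with rfl | hu
    · rwa [Function.update_self]
    · rw [hne u hu]
      exact hW.1 u hu huT
  · filter_upwards [hle, hsupp] with ω h1 h2
    rw [strategyCost_eq_add ht, Function.update_self, strategyCost_congr hne, EReal.coe_add]
    exact add_le_add le_rfl ((EReal.coe_le_coe_iff.2 h1).trans
      (le_iSup₂ (f := fun s (_ : s ∈ φ t (S t ω)) => (f s (Y ω) : EReal)) _ h2))

/-- Every strategy costs at least `stepCost` for its first trade. -/
theorem IsHedgingValue.stepCost_le (h : IsHedgingValue P F T S C ξ (t + 1) f)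
    (hf : LowerSemicontinuous fun p : (Fin k → ℝ) × (Fin d → ℝ) => f p.1 p.2)
    (ht : t < T) (hC : Measurable fun p : (Fin k → ℝ) × (Fin d → ℝ) => C t p.1 p.2)
    (hS : Measurable[F t] (S t))
    (hsupp : IsCondSupport (F t) P (S (t + 1)) fun ω => φ t (S t ω))
    {V : Ω → (Fin d → ℝ)} (hV : Measurable[F t] V) {W : ℕ → Ω → (Fin d → ℝ)}
    (hW : IsStrategy F T ξ t W) :
    ∀ᵐ ω ∂P, stepCost (C t) (φ t) f ((S t ω, V ω), W t ω) ≤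
      condStrategyCost P F T S C ξ t V W ω := by
  have hWt : Measurable[F t] (W t) := hW.1 t le_rfl ht
  have hZ := isCondEssSup_condEssSup (F.le t) P {fun ω => (strategyCost T S C ξ t V W ω : EReal)}
  set Z : Ω → EReal := condStrategyCost P F T S C ξ t V W
  have hcm : Measurable[F t] fun ω => (C t (S t ω) (risky (W t ω - V ω)) : EReal) := by
    have h1 : Measurable[F t] fun ω => risky (W t ω - V ω) :=
      (continuous_risky (d := d)).measurable.comp (hWt.sub hV)
    exact measurable_coe_real_ereal.comp (hC.comp (hS.prodMk h1))
  have hZc : Measurable[F t] fun ω => Z ω - (C t (S t ω) (risky (W t ω - V ω)) : EReal) := by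
    simp only [sub_eq_add_neg]
    exact hZ.1.add ((measurable_neg (G := EReal)).comp hcm)
  -- The conditional cost minus that of the first trade is an `F t`-measurable bound on the
  -- remaining cost, hence on `f (S (t + 1))` at `W t`, and so on the supremum over the conditional
  -- support.
  have h1 : condStrategyCost P F T S C ξ (t + 1) (W t) W ≤ᵐ[P]
      fun ω => Z ω - (C t (S t ω) (risky (W t ω - V ω)) : EReal) := by
    refine condEssSup_singleton_ae_le (F.le (t + 1)) (hZc.mono (F.mono t.le_succ) le_rfl) ?_
    filter_upwards [hZ.2.1 _ rfl] with ω hω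
    rw [strategyCost_eq_add ht, add_comm, EReal.coe_add] at hω
    exact (EReal.le_sub_iff_add_le (Or.inl (EReal.coe_ne_bot _))
      (Or.inl (EReal.coe_ne_top _))).2 hω
  have h2 := h.le_cost (W t) (hWt.mono (F.mono t.le_succ) le_rfl) W
    ⟨fun u hu => hW.1 u (by omega), hW.2⟩
  have h3 := hsupp.ae_iSup_le hf hWt hZc (by
    filter_upwards [h1, h2] with ω h4 h5 using h5.trans h4)
  filter_upwards [h3] with ω h4
  rw [EReal.le_sub_iff_add_le (Or.inl (EReal.coe_ne_bot _)) (Or.inl (EReal.coe_ne_top _)),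
    add_comm] at h4
  exact h4

/-- `oneStepCost` for the zero claim, in terms of the value function of the next date. -/
theorem IsHedgingValue.oneStepCost_ae_eq (h : IsHedgingValue P F T S C ξ (t + 1) f)
    (hf : LowerSemicontinuous fun p : (Fin k → ℝ) × (Fin d → ℝ) => f p.1 p.2)
    (hφ : LowerHemicontinuous (φ t)) (hS : Measurable[F t] (S t))
    (hS' : Measurable[F (t + 1)] (S (t + 1)))
    (hsupp : IsCondSupport (F t) P (S (t + 1)) fun ω => φ t (S t ω))
    (V : Ω → (Fin d → ℝ)) {Z : Ω → (Fin d → ℝ)} (hZ : Measurable[F t] Z) :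
    oneStepCost P F T S C ξ t V Z =ᵐ[P]
      fun ω => stepCost (C t) (φ t) f ((S t ω, V ω), Z ω) := by
  have h1 := h.hedgingCost_ae_eq hf hS' (hZ.mono (F.mono t.le_succ) le_rfl)
  have h2 : condEssSup (F t) P {hedgingCost P F T S C ξ (t + 1) Z} ≤ᵐ[P]
      fun ω => ⨆ s ∈ φ t (S t ω), (f s (Z ω) : EReal) := by
    refine condEssSup_singleton_ae_le (F.le t) (measurable_iSup_comp hφ hf hS hZ) ?_
    filter_upwards [h1, hsupp.2.1] with ω h3 h4
    exact h3.trans_le (le_iSup₂ (f := fun s (_ : s ∈ φ t (S t ω)) => (f s (Z ω) : EReal)) _ h4)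
  have h5 := hsupp.ae_iSup_le hf hZ
    (isCondEssSup_condEssSup (F.le t) P {hedgingCost P F T S C ξ (t + 1) Z}).1 (by
      filter_upwards [h1, ae_le_condEssSup_singleton (P := P) (F.le t)
        (hedgingCost P F T S C ξ (t + 1) Z)] with ω h3 h4
      exact h3.symm.trans_le h4)
  filter_upwards [h2, h5] with ω h6 h7
  rw [oneStepCost, stepCost, le_antisymm h6 h7]

end market


/-! ### The terminal date -/

section deterministic

variable {d k : ℕ} [NeZero d] {δ : ℝ≥0∞ ≃o ℝ≥0∞}

/-- The set of points at which a lower hemicontinuous multifunction lies in a ball with continuous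
radius is closed. -/
theorem LowerHemicontinuous.isClosed_setOf_subset_closedBall {E G : Type*} [TopologicalSpace E]
    [SeminormedAddCommGroup G] {φ : E → Set G} (hφ : LowerHemicontinuous φ) {R : E → ℝ}
    (hR : Continuous R) : IsClosed {e | φ e ⊆ Metric.closedBall 0 (R e)} := by
  have h1 : LowerSemicontinuous fun p : G × E => ‖p.1‖ - R p.2 :=
    (continuous_fst.norm.sub (hR.comp continuous_snd)).lowerSemicontinuous
  -- The set in question is the sublevel set at `0` of this function.
  have h2 : LowerSemicontinuous fun e : E => ⨆ s ∈ φ e, ((‖s‖ - R e : ℝ) : EReal) :=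
    (hφ.lowerSemicontinuous_iSup (f := fun s e => ‖s‖ - R e) h1).comp
      (g := fun e : E => (e, e)) (continuous_id.prodMk continuous_id)
  convert h2.isClosed_preimage ((0 : ℝ) : EReal) using 1
  ext e
  simp only [Set.mem_ofPred_eq, Set.mem_preimage, Set.mem_Iic, iSup_le_iff, EReal.coe_le_coe_iff,
    sub_nonpos, Set.subset_def, mem_closedBall_zero_iff]

/-- The terminal cost of delivering `g s` from the position `v`. -/
def terminalCost (c : (Fin k → ℝ) → (Fin d → ℝ) → ℝ) (g : (Fin k → ℝ) → (Fin d → ℝ))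
    (s : Fin k → ℝ) (v : Fin d → ℝ) : ℝ :=
  g s 0 + c s (risky (g s - v))

theorem lowerSemicontinuous_terminalCost {c : (Fin k → ℝ) → (Fin d → ℝ) → ℝ}
    (hc : IsCostFunction δ c) {g : (Fin k → ℝ) → (Fin d → ℝ)} (hg : Continuous g) :
    LowerSemicontinuous fun p : (Fin k → ℝ) × (Fin d → ℝ) => terminalCost c g p.1 p.2 := by
  have h1 : Continuous fun p : (Fin k → ℝ) × (Fin d → ℝ) => g p.1 0 :=
    (continuous_apply 0).comp (hg.comp continuous_fst)
  have h2 : Continuous fun p : (Fin k → ℝ) × (Fin d → ℝ) => (p.1, risky (g p.1 - p.2)) :=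
    continuous_fst.prodMk (continuous_risky.comp ((hg.comp continuous_fst).sub continuous_snd))
  have h3 : LowerSemicontinuous fun p : (Fin k → ℝ) × (Fin d → ℝ) =>
      c p.1 (risky (g p.1 - p.2)) := hc.lsc.comp h2
  exact h1.lowerSemicontinuous.add h3

theorem isValuePair_terminalCost {c : (Fin k → ℝ) → (Fin d → ℝ) → ℝ}
    (hc : IsCostFunction δ c)
    (hcash : ∀ s, 0 ≤ s → ∀ (z : Fin d → ℝ) (a : ℝ), c s (z + a • cashUnit d) = c s z + a)
    (hmono : ∀ s, 0 ≤ s → ∀ x y : Fin d → ℝ, x ≤ y → c s x ≤ c s y)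
    {g : (Fin k → ℝ) → (Fin d → ℝ)} (hg : Continuous g) (hg0 : ∀ s, 0 ≤ g s)
    {K : Set (Fin k → ℝ)} (hK : ∀ s ∈ K, 0 ≤ s) :
    IsValuePair δ K (terminalCost c fun _ => 0) (terminalCost c g) where
  lsc_zero := lowerSemicontinuous_terminalCost hc continuous_const
  lsc := lowerSemicontinuous_terminalCost hc hg
  risky_zero s v := by simp only [terminalCost, risky_sub, risky_risky]
  risky s v := by simp only [terminalCost, risky_sub, risky_risky]
  le s hs v := by
    -- Cash invariance absorbs the payment `g s 0` into the position, so that the terminal cost is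
    -- `c s (g s - risky v)`; monotonicity and `0 ≤ g s` then give the comparison with the zero
    -- claim.
    have h1 := hcash s (hK s hs) (risky (g s - v)) (g s 0)
    have h2 : risky (g s - v) + g s 0 • cashUnit d = g s - risky v := by
      rw [risky_sub, sub_add_eq_add_sub, risky_add_smul_cashUnit]
    have h3 := hmono s (hK s hs) (risky (0 - v)) (g s - risky v) (by
      rw [risky_sub, risky_zero]
      exact sub_le_sub_right (hg0 s) _)
    rw [← h2, h1] at h3
    simp only [terminalCost, Pi.zero_apply]
    linarith
  hom a ha s hs v := by
    have h1 := hc.hom a ha s (hK s hs) (risky (0 - v))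
    rw [← risky_smul, smul_sub, smul_zero] at h1
    simpa [terminalCost] using h1
  bounded := by
    obtain ⟨h, hh, hb⟩ := hc.bounded
    refine ⟨fun q => g q.1 0 + h (q.1, risky (g q.1 - q.2)), ?_, fun s hs v => ?_⟩
    · have := continuous_risky (d := d)
      have h1 : Continuous fun q : (Fin k → ℝ) × (Fin d → ℝ) => g q.1 0 :=
        (continuous_apply 0).comp (hg.comp continuous_fst)
      exact h1.add (by fun_prop)
    · exact add_le_add le_rfl ((le_abs_self _).trans (hb s (hK s hs) _))

end deterministic

/-! ### The backward recursion -/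

section market

variable {Ω : Type*} {mΩ : MeasurableSpace Ω} {P : Measure Ω} [IsProbabilityMeasure P]
  {F : Filtration ℕ mΩ} {T : ℕ} {d k : ℕ} [NeZero d]
  {S : ℕ → Ω → (Fin k → ℝ)} {C : ℕ → (Fin k → ℝ) → (Fin d → ℝ) → ℝ} {ξ : Ω → (Fin d → ℝ)}
  {φ : ℕ → (Fin k → ℝ) → Set (Fin k → ℝ)} {t : ℕ} {f f₀ : (Fin k → ℝ) → (Fin d → ℝ) → ℝ}
  {δ : ℝ≥0∞ ≃o ℝ≥0∞}

theorem IsMarket.isCostFunction (hmarket : IsMarket P F T S C) (ht : t ≤ T)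
    (hhom : IsSuperHomogeneous δ (C t)) (hadd : IsSuperAdditive (C t) ∨ IsSubAdditive (C t)) :
    IsCostFunction δ (C t) where
  lsc := (hmarket.normal t ht).2 (nonempty_of_isProbabilityMeasure P).some
  bounded := hmarket.bounded t ht
  hom := hhom
  add := hadd

omit [IsProbabilityMeasure P] in
-- Completeness of the filtration. It makes the event that `S t` lies in the no-arbitrage set
-- measurable without describing that set.
theorem IsMarket.measurableSet_of_ae (hmarket : IsMarket P F T S C) (t : ℕ) {A : Set Ω}
    (hA : ∀ᵐ ω ∂P, ω ∈ A) : MeasurableSet[F t] A := by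
  have h : MeasurableSet[F t] Aᶜ := F.mono t.zero_le _ (hmarket.complete _ hA)
  simpa using h.compl

theorem isHedgingValue_terminalCost (g : (Fin k → ℝ) → (Fin d → ℝ)) :
    IsHedgingValue P F T S C (fun ω => g (S T ω)) T (terminalCost (C T) g) where
  le_cost V _ W hW := by
    filter_upwards [ae_le_condEssSup_singleton (P := P) (F.le T)
      fun ω => (strategyCost T S C (fun ω => g (S T ω)) T V W ω : EReal)] with ω hω
    refine le_trans (le_of_eq ?_) hω
    rw [strategyCost_self, hW.2, terminalCost]
  exists_le V _ := by
    refine ⟨fun _ ω => g (S T ω), ⟨fun u h1 h2 => absurd h2 (not_lt.2 h1), rfl⟩, ?_⟩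
    refine Eventually.of_forall fun ω => ?_
    rw [strategyCost_self, terminalCost]

/-- Under SAIP the market data lie almost surely in the no-arbitrage set. -/
theorem SAIP.ae_mem_noArbitrageSet (hSAIP : SAIP P F T S C) (ht : t < T)
    (hc : IsCostFunction δ (C t)) (hφ : LowerHemicontinuous (φ t)) (hS : Measurable[F t] (S t))
    (hS' : Measurable[F (t + 1)] (S (t + 1)))
    (hsupp : IsCondSupport (F t) P (S (t + 1)) fun ω => φ t (S t ω))
    (hf : LowerSemicontinuous fun p : (Fin k → ℝ) × (Fin d → ℝ) => f p.1 p.2)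
    (hfr : ∀ s v, f s (risky v) = f s v)
    (h : IsHedgingValue P F T S C 0 (t + 1) f) {K : Set (Fin k → ℝ)}
    (hK : ∀ᵐ ω ∂P, S t ω ∈ K) :
    ∀ᵐ ω ∂P, S t ω ∈ noArbitrageSet K (C t) (φ t) f := by
  have hD : LowerSemicontinuous fun p : (Fin k → ℝ) × (Fin d → ℝ) =>
      stepCost (C t) (φ t) f ((p.1, 0), p.2) :=
    (lowerSemicontinuous_stepCost hc hφ hf).comp
      (g := fun p : (Fin k → ℝ) × (Fin d → ℝ) => ((p.1, (0 : Fin d → ℝ)), p.2)) (by fun_prop)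
  have hm0 : Measurable[F t] (0 : Ω → (Fin d → ℝ)) := @measurable_const _ _ _ (F t) 0
  have hone : ∀ Z : Ω → (Fin d → ℝ), Measurable[F t] Z →
      oneStepCost P F T S C 0 t 0 Z =ᵐ[P]
        fun ω => stepCost (C t) (φ t) f ((S t ω, 0), Z ω) := fun Z hZ =>
    h.oneStepCost_ae_eq hf hφ hS hS' hsupp 0 hZ
  -- Trading to `Z` and continuing optimally is a strategy for the zero claim, whose infimum cost is
  -- `0`.
  have hnonneg : ∀ Z : Ω → (Fin d → ℝ), Measurable[F t] Z →
      ∀ᵐ ω ∂P, 0 ≤ stepCost (C t) (φ t) f ((S t ω, 0), Z ω) := by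
    intro Z hZ
    obtain ⟨W, hW, hle⟩ := h.exists_strategyCost_le ht hsupp.2.1 0 hZ
    have h1 := (isCondEssInf_condEssInf (F.le t) P
      {X | ∃ W, IsStrategy F T 0 t W ∧ X = condStrategyCost P F T S C 0 t 0 W}).2.1 _ ⟨W, hW, rfl⟩
    have h2 : condStrategyCost P F T S C 0 t 0 W ≤ᵐ[P] _ := condEssSup_singleton_ae_le (F.le t)
      (measurable_stepCost_comp hc hφ hf hS hm0 hZ) hle
    filter_upwards [h1, h2, hSAIP.1 t ht.le] with ω h3 h4 h5
    exact (h5.symm.trans_le h3).trans h4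
  have hzero : ∀ᵐ ω ∂P, stepCost (C t) (φ t) f ((S t ω, 0), 0) = 0 := by
    have h1 : oneStepCost P F T S C 0 t 0 0 =ᵐ[P] 0 :=
      (hSAIP.2 t ht 0 hm0).2 (Eventually.of_forall fun ω => risky_zero)
    filter_upwards [h1, hone 0 hm0] with ω h2 h3
    exact h3.symm.trans h2
  -- Compact annuli that exhaust the nonzero positions without cash.
  let B : ℕ → Set (Fin d → ℝ) := fun n =>
    Metric.closedBall 0 (n + 1) ∩ ({y | y 0 = 0} ∩ {y | ((n : ℝ) + 1)⁻¹ ≤ ‖y‖})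
  have hB : ∀ n, IsCompact (B n) := fun n => (isCompact_closedBall _ _).inter_right
    ((isClosed_eq (continuous_apply 0) continuous_const).inter
      (isClosed_le continuous_const continuous_norm))
  have hpos : ∀ n, ∀ᵐ ω ∂P, ¬ ∃ y ∈ B n, stepCost (C t) (φ t) f ((S t ω, 0), y) ≤ (0 : ℝ) := by
    intro n
    let G : Set Ω := {ω | ∃ y ∈ B n, stepCost (C t) (φ t) f ((S t ω, 0), y) ≤ (0 : ℝ)}
    have hG : MeasurableSet[F t] G := by
      have h1 : Measurable[F t] fun ω => ⨅ y ∈ B n, stepCost (C t) (φ t) f ((S t ω, 0), y) :=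
        (hD.iInf_of_isCompact (hB n)).measurable.comp hS
      have h2 : MeasurableSet[F t]
          {ω | ⨅ y ∈ B n, stepCost (C t) (φ t) f ((S t ω, 0), y) ≤ ((0 : ℝ) : EReal)} :=
        measurableSet_le h1 measurable_const
      convert h2 using 1
      ext ω
      exact (hD.iInf_le_iff_of_isCompact (hB n) (S t ω) 0).symm
    -- The selection `Z` costs at most `0` on `G` and vanishes elsewhere, so its cost is `0` almost
    -- surely. SAIP then forces `Z = 0`, which the annulus excludes on `G`; hence `G` is null.
    obtain ⟨Z, hZ, hZG, hZ0⟩ := hD.exists_measurable_sublevel_selection hS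
      (c := fun _ => 0) measurable_const (hB n).isClosed hG (fun ω hω => hω)
      (fun ω _ => ⟨n + 1, fun y hy _ => mem_closedBall_zero_iff.1 hy.1⟩)
    have h1 : oneStepCost P F T S C 0 t 0 Z =ᵐ[P] 0 := by
      filter_upwards [hone Z hZ, hnonneg Z hZ, hzero] with ω h2 h3 h4
      rw [h2]
      by_cases hω : ω ∈ G
      · exact le_antisymm (hZG ω hω).2 h3
      · rw [hZ0 ω hω]
        exact h4
    filter_upwards [(hSAIP.2 t ht Z hZ).1 h1] with ω h2 hω
    have h3 := (hZG ω hω).1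
    have h4 : Z ω = 0 := (risky_eq_self h3.2.1).symm.trans h2
    have h5 : ((n : ℝ) + 1)⁻¹ ≤ ‖Z ω‖ := h3.2.2
    rw [h4, norm_zero] at h5
    exact absurd h5 (not_le.2 (by positivity))
  filter_upwards [ae_all_iff.2 hpos, hzero, hK, hsupp.2.1] with ω h1 h2 h3 h4
  have h5 : ∀ z, risky z ≠ 0 → 0 < stepCost (C t) (φ t) f ((S t ω, 0), z) := by
    intro z hz
    rw [← stepCost_risky_right hfr]
    by_contra! hle
    obtain ⟨n₁, hn₁⟩ := exists_nat_ge ‖risky z‖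
    obtain ⟨n₂, hn₂⟩ := exists_nat_ge ‖risky z‖⁻¹
    refine h1 (max n₁ n₂) ⟨risky z, ⟨?_, risky_apply_zero z, ?_⟩, hle⟩
    · rw [mem_closedBall_zero_iff]
      have : (n₁ : ℝ) ≤ (max n₁ n₂ : ℕ) := by exact_mod_cast le_max_left _ _
      linarith
    · have : (n₂ : ℝ) ≤ (max n₁ n₂ : ℕ) := by exact_mod_cast le_max_right _ _
      exact inv_le_of_inv_le₀ (norm_pos_iff.2 hz) (by linarith)
  refine ⟨h3, ⟨_, h4⟩, fun z => ?_, h5⟩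
  by_cases hz : risky z = 0
  · rw [← stepCost_risky_right hfr, hz, h2]
  · exact (h5 z hz).le

/-- `f` satisfies the dynamic programming equation at time `t` with next value function `f'`, and
the infimum is attained at a measurable position. -/
def HasOptimalStep {Ω : Type*} {mΩ : MeasurableSpace Ω} (P : Measure Ω)
    (F : Filtration ℕ mΩ) {d k : ℕ} [NeZero d] (S : ℕ → Ω → (Fin k → ℝ))
    (C : ℕ → (Fin k → ℝ) → (Fin d → ℝ) → ℝ) (φ : ℕ → (Fin k → ℝ) → Set (Fin k → ℝ)) (t : ℕ)
    (f f' : (Fin k → ℝ) → (Fin d → ℝ) → ℝ) : Prop :=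
  ∀ V : Ω → (Fin d → ℝ), Measurable[F t] V →
    (∀ᵐ ω ∂P, (f (S t ω) (V ω) : EReal) = stepValue (C t) (φ t) f' (S t ω, V ω)) ∧
    ∃ Y : Ω → (Fin d → ℝ), Measurable[F t] Y ∧
      ∀ᵐ ω ∂P, (f (S t ω) (V ω) : EReal) = stepCost (C t) (φ t) f' ((S t ω, V ω), Y ω)

omit [IsProbabilityMeasure P] in
theorem hasOptimalStep_of_eq_stepValue {K K' : Set (Fin k → ℝ)}
    {f' f₀' : (Fin k → ℝ) → (Fin d → ℝ) → ℝ}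
    (hmarket : IsMarket P F T S C) (hc : IsCostFunction δ (C t))
    (hφ : LowerHemicontinuous (φ t)) (hS : Measurable[F t] (S t))
    (hK : ∀ s ∈ K, 0 ≤ s) (hφK : ∀ s ∈ K, φ t s ⊆ K') (hf' : IsValuePair δ K' f₀' f')
    (hmem : ∀ᵐ ω ∂P, S t ω ∈ noArbitrageSet K (C t) (φ t) f₀')
    (hf : LowerSemicontinuous fun p : (Fin k → ℝ) × (Fin d → ℝ) => f p.1 p.2)
    (heq : ∀ s ∈ noArbitrageSet K (C t) (φ t) f₀', ∀ v,
      (f s v : EReal) = stepValue (C t) (φ t) f' (s, v)) :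
    HasOptimalStep P F S C φ t f f' := by
  intro V hV
  refine ⟨hmem.mono fun ω hω => heq _ hω _, ?_⟩
  -- As `f` is the minimal cost, its level set is the set of minimisers; it is nonempty, and bounded
  -- by coercivity.
  obtain ⟨Y, hY, hYle, -⟩ :=
    (lowerSemicontinuous_stepCost hc hφ hf'.lsc).exists_measurable_sublevel_selection
      (hS.prodMk hV) (c := fun q => f q.1 q.2) hf.measurable
      (B₀ := {y | y 0 = 0}) (isClosed_eq (continuous_apply 0) continuous_const)
      (hmarket.measurableSet_of_ae t hmem)
      (fun ω hω => exists_stepCost_le_stepValue hc hφ hK hφK hf' hω (heq _ hω _).symm)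
      (fun ω hω => by
        obtain ⟨r, hr⟩ := eventually_norm_le_of_stepCost_le hc hφ hK hφK hf' hω (V ω)
          (f (S t ω) (V ω))
        exact ⟨r, hr.self_of_nhds hω.1⟩)
  refine ⟨Y, hY, hmem.mono fun ω hω => le_antisymm ?_ (hYle ω hω).2⟩
  rw [heq _ hω]
  exact iInf_le _ _

/-- Any strategy pays at least the step cost of its first trade, hence at least the infimum; trading
to the minimiser `Y` and then hedging optimally attains it. -/
theorem HasOptimalStep.isHedgingValue {f' : (Fin k → ℝ) → (Fin d → ℝ) → ℝ}
    (h : HasOptimalStep P F S C φ t f f') (h' : IsHedgingValue P F T S C ξ (t + 1) f')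
    (hf' : LowerSemicontinuous fun p : (Fin k → ℝ) × (Fin d → ℝ) => f' p.1 p.2)
    (ht : t < T) (hc : IsCostFunction δ (C t)) (hS : Measurable[F t] (S t))
    (hsupp : IsCondSupport (F t) P (S (t + 1)) fun ω => φ t (S t ω)) :
    IsHedgingValue P F T S C ξ t f where
  le_cost V hV W hW := by
    filter_upwards [(h V hV).1, h'.stepCost_le hf' ht hc.lsc.measurable hS hsupp hV hW]
      with ω h1 h2
    exact h1.trans_le ((iInf_le _ _).trans h2)
  exists_le V hV := by
    obtain ⟨Y, hY, hYeq⟩ := (h V hV).2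
    obtain ⟨W, hW, hle⟩ := h'.exists_strategyCost_le ht hsupp.2.1 V hY
    refine ⟨W, hW, ?_⟩
    filter_upwards [hYeq, hle] with ω h1 h2
    exact EReal.coe_le_coe_iff.1 (h2.trans_eq h1.symm)

/-- The backward recursion: there are value functions from time `t` on. -/
theorem exists_valueFunctions (hmarket : IsMarket P F T S C)
    (hhom : ∀ t ≤ T, IsSuperHomogeneous δ (C t))
    (hadd : ∀ t ≤ T, IsSuperAdditive (C t) ∨ IsSubAdditive (C t))
    {g : (Fin k → ℝ) → (Fin d → ℝ)} (hg : Continuous g) (hg0 : ∀ s, 0 ≤ g s)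
    (hφ : HasMarkovSupport P F T S φ) (hSAIP : SAIP P F T S C) (ht : t ≤ T) :
    ∃ γ₀ γ : ℕ → (Fin k → ℝ) → (Fin d → ℝ) → ℝ, ∀ u, t ≤ u → u ≤ T →
      IsValuePair δ (P.map (S u)).support (γ₀ u) (γ u) ∧
      IsHedgingValue P F T S C 0 u (γ₀ u) ∧
      IsHedgingValue P F T S C (fun ω => g (S T ω)) u (γ u) ∧
      (u < T → HasOptimalStep P F S C φ u (γ u) (γ (u + 1))) := by
  have hSm : ∀ u ≤ T, Measurable (S u) := fun u hu =>
    (hmarket.adapted u hu).mono (F.le u) le_rfl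
  have hSK : ∀ u ≤ T, ∀ᵐ ω ∂P, S u ω ∈ (P.map (S u)).support := fun u hu =>
    ae_mem_support_map (hSm u hu)
  have hK : ∀ u ≤ T, ∀ s ∈ (P.map (S u)).support, 0 ≤ s := fun u hu s hs =>
    support_map_subset (hSm u hu) (A := Set.Ici 0) isClosed_Ici (hmarket.nonneg u hu) hs
  have hc : ∀ u ≤ T, IsCostFunction δ (C u) := fun u hu =>
    hmarket.isCostFunction hu (hhom u hu) (hadd u hu)
  induction ht using Nat.decreasingInduction with
  | self =>
    refine ⟨fun _ => terminalCost (C T) fun _ => 0, fun _ => terminalCost (C T) g,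
      fun u hu huT => ?_⟩
    obtain rfl := le_antisymm huT hu
    exact ⟨isValuePair_terminalCost (hc u le_rfl) (hmarket.cash_invariant u le_rfl)
        hmarket.increasing hg hg0 (hK u le_rfl),
      isHedgingValue_terminalCost fun _ => 0, isHedgingValue_terminalCost g,
      fun h => absurd h (lt_irrefl u)⟩
  | of_succ t ht ih =>
    obtain ⟨γ₀, γ, hγ⟩ := ih
    obtain ⟨hpair, hval₀, hval, -⟩ := hγ (t + 1) le_rfl ht
    obtain ⟨hlhc, -, hsupp, R, hR, hφR⟩ := hφ t ht
    have hSt := hmarket.adapted t ht.le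
    -- By lower hemicontinuity the points `s` with `φ t s` inside a given closed set form a closed
    -- set; it contains `S t` almost surely, hence the support of its law. The ball bound and the
    -- closure of the no-arbitrage set are handled likewise.
    have hφK : ∀ s ∈ (P.map (S t)).support, φ t s ⊆ (P.map (S (t + 1))).support :=
      support_map_subset (hSm t ht.le)
        (lowerHemicontinuous_iff_isClosed_preimage_Iic.1 hlhc _ Measure.isClosed_support)
        (hsupp.ae_subset Measure.isClosed_support (hSK (t + 1) ht))
    have hφR' : ∀ s ∈ (P.map (S t)).support, φ t s ⊆ Metric.closedBall 0 (R s) :=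
      support_map_subset (hSm t ht.le) (hlhc.isClosed_setOf_subset_closedBall hR) hφR
    have hmem := hSAIP.ae_mem_noArbitrageSet ht (hc t ht.le) hlhc hSt (hmarket.adapted (t + 1) ht)
      hsupp hpair.lsc_zero hpair.risky_zero hval₀ (hSK t ht.le)
    have hcl := support_map_subset (hSm t ht.le) isClosed_closure
      (hmem.mono fun ω hω => subset_closure hω)
    obtain ⟨f₀, f, hpair', heq₀, heq⟩ := exists_isValuePair_step (hc t ht.le) hlhc (hK t ht.le)
      hφK hR hφR' hpair hcl
    have hopt₀ := hasOptimalStep_of_eq_stepValue hmarket (hc t ht.le) hlhc hSt (hK t ht.le) hφK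
      hpair.left hmem hpair'.lsc_zero heq₀
    have hopt := hasOptimalStep_of_eq_stepValue hmarket (hc t ht.le) hlhc hSt (hK t ht.le) hφK
      hpair hmem hpair'.lsc heq
    refine ⟨Function.update γ₀ t f₀, Function.update γ t f, fun u hu huT => ?_⟩
    rcases hu.eq_or_lt with rfl | hu
    · rw [Function.update_self, Function.update_self,
        Function.update_of_ne (Nat.succ_ne_self t)]
      exact ⟨hpair', hopt₀.isHedgingValue hval₀ hpair.lsc_zero ht (hc t ht.le) hSt hsupp,
        hopt.isHedgingValue hval hpair.lsc ht (hc t ht.le) hSt hsupp, fun _ => hopt⟩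
    · rw [Function.update_of_ne hu.ne', Function.update_of_ne hu.ne',
        Function.update_of_ne (by omega)]
      exact hγ u hu huT

end market

end

/-! ### Representation of the infimum hedging cost -/

theorem mainTheorem2 {Ω : Type*} [mΩ : MeasurableSpace Ω] (P : Measure Ω) [IsProbabilityMeasure P]
    (F : Filtration ℕ mΩ) (T : ℕ) {d k : ℕ} [NeZero d]
    (S : ℕ → Ω → (Fin k → ℝ)) (C : ℕ → (Fin k → ℝ) → (Fin d → ℝ) → ℝ)
    (hmarket : IsMarket P F T S C)
    (δ : ℝ≥0∞ ≃o ℝ≥0∞) (hhom : ∀ t ≤ T, IsSuperHomogeneous δ (C t))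
    (hadd : ∀ t ≤ T, IsSuperAdditive (C t) ∨ IsSubAdditive (C t))
    (g : (Fin k → ℝ) → (Fin d → ℝ)) (hg : Continuous g) (hg0 : ∀ s, 0 ≤ g s)
    (hhedge : IsHedgeable P F T S C (fun ω => g (S T ω)))
    (φ : ℕ → (Fin k → ℝ) → Set (Fin k → ℝ)) (hφ : HasMarkovSupport P F T S φ)
    (hSAIP : SAIP P F T S C) :
    ∃ γ : ℕ → (Fin k → ℝ) → (Fin d → ℝ) → ℝ,
      -- each `γ t` is an `F t`-normal integrand
      (∀ t ≤ T, IsNormalIntegrand (F t)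
        (fun (_ : Ω) (p : (Fin k → ℝ) × (Fin d → ℝ)) => γ t p.1 p.2)) ∧
      -- which represents the infimum hedging cost
      (∀ t ≤ T, ∀ V : Ω → (Fin d → ℝ), Measurable[F t] V →
        hedgingCost P F T S C (fun ω => g (S T ω)) t V =ᵐ[P]
          fun ω => (γ t (S t ω) (V ω) : EReal)) ∧
      -- the dynamic programming principle holds pointwise in `ω`, and its infimum is attained
      -- by a measurable selection
      (∀ t < T, ∀ V : Ω → (Fin d → ℝ), Measurable[F t] V →
        (∀ᵐ ω ∂P, (γ t (S t ω) (V ω) : EReal) =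
          ⨅ y : Fin d → ℝ, ((C t (S t ω) (risky (y - V ω)) : ℝ) : EReal) +
            ⨆ s ∈ φ t (S t ω), (γ (t + 1) s y : EReal)) ∧
        ∃ Y : Ω → (Fin d → ℝ), Measurable[F t] Y ∧
          ∀ᵐ ω ∂P, (γ t (S t ω) (V ω) : EReal) =
            ((C t (S t ω) (risky (Y ω - V ω)) : ℝ) : EReal) +
              ⨆ s ∈ φ t (S t ω), (γ (t + 1) s (Y ω) : EReal)) ∧
      -- the infimum hedging cost is the cost of some strategy
      (∀ t ≤ T, ∀ V : Ω → (Fin d → ℝ), Measurable[F t] V →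
        ∃ W : ℕ → Ω → (Fin d → ℝ), IsStrategy F T (fun ω => g (S T ω)) t W ∧
          hedgingCost P F T S C (fun ω => g (S T ω)) t V =ᵐ[P]
            condStrategyCost P F T S C (fun ω => g (S T ω)) t V W) := by
  obtain ⟨γ₀, γ, hγ⟩ := exists_valueFunctions hmarket hhom hadd hg hg0 hφ hSAIP T.zero_le
  refine ⟨γ, fun t ht => ?_, fun t ht V hV => ?_, fun t ht V hV => ?_, fun t ht V hV => ?_⟩
  · have hlsc := (hγ t t.zero_le ht).1.lsc
    exact ⟨hlsc.measurable.comp measurable_snd, fun _ => hlsc⟩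
  · obtain ⟨hpair, -, hval, -⟩ := hγ t t.zero_le ht
    exact hval.hedgingCost_ae_eq hpair.lsc (hmarket.adapted t ht) hV
  · exact (hγ t t.zero_le ht.le).2.2.2 ht V hV
  · obtain ⟨hpair, -, hval, -⟩ := hγ t t.zero_le ht
    obtain ⟨W, hW, hWeq⟩ := hval.exists_condStrategyCost_ae_eq hpair.lsc (hmarket.adapted t ht) hV
    exact ⟨W, hW, (hval.hedgingCost_ae_eq hpair.lsc (hmarket.adapted t ht) hV).trans hWeq.symm⟩
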